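/- For a real exponent $n$ consider the class of equations $$u_t+u^nu_x+\alpha(t)u+\beta(t)u_{xxxxx}=0,\qquad (1)$$ where $\alpha,\beta$ are arbitrary smooth real functions on a nonempty open interval $I$ and $\beta$ vanishes nowhere on $I$. Here either $n\geqslant 2$ is an integer and $u$ takes values in $U=\mathbb R$, or $n\neq 0,1$ is any real number and $u$ takes values in $U=(0,\infty)$; the exponent $n$ (with $U$) is fixed. The maximal Lie invariance algebra $A^{\max}$ of an equation (1) consists of all smooth vector fields $Q=\tau\partial_t+\xi\partial_x+\eta\partial_u$ on $I\times\mathbb R\times U$ (with $\tau,\xi,\eta$ functions of $(t,x,u)$) whose fifth prolongation $Q^{(5)}$ annihilates the left-hand side of (1) at every fifth-order jet satisfying (1). Let $G^\sim$ consist of the transformations $$\tilde t=T(t),\quad \tilde x=\delta_1x+\delta_2,\quad \tilde u=\Bigl(\frac{\delta_1}{T_t}\Bigr)^{1/n}u,\quad \tilde\alpha(\tilde t)=\frac{\alpha(t)}{T_t}+\frac{T_{tt}}{nT_t^2},\quad \tilde\beta(\tilde t)=\frac{\delta_1^5}{T_t}\beta(t),$$ where $\delta_1,\delta_2$ are constants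 and $T$ is a smooth function on $I$ with $\delta_1T_t>0$; the transformed equation is considered on the interval $T(I)$. Then the following list is the group classification list of the class (1) up to $G^\sim$-equivalence ($\alpha=0$ in Cases 2--4, $\varepsilon=\pm1$, and $\rho$ is an arbitrary nonzero constant): 1. arbitrary equation (1): $\langle\partial_x\rangle$; 2. $\beta=\varepsilon t^\rho$ ($t>0$): basis $\partial_x,\ 5nt\partial_t+(\rho+1)nx\partial_x+(\rho-4)u\partial_u$; 3. $\beta=\varepsilon e^t$: basis $\partial_x,\ 5n\partial_t+nx\partial_x+u\partial_u$; 4. $\beta=\varepsilon$: basis $\partial_x,\ \partial_t,\ 5nt\partial_t+nx\partial_x-4u\partial_u$. That is: (a) every equation (1) is mapped by a transformation from $G^\sim$ to an equation (1) with $\alpha=0$; (b) whenever a transformation from $G^\sim$ maps one equation (1) to another, it identifies their algebras $A^{\max}$; (c) for every nonempty open interval $I$ the kernel, that is, the intersection of the algebras $A^{\max}$ of all equations (1) on $I$, is $\langle\partial_x\rangle$; (d) in Cases 2--4, on any nonempty open interval of (in Case 2, positive) values of $t$, the listed operators form a basis of $A^{\max}$; (e) an equation (1) has $A^{\max}\neq\langle\partial_x\rangle$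 if and only if it is $G^\sim$-equivalent to an equation from Cases 2--4 on some open interval; (f) equations from Cases 2--4 (on any intervals) that differ in the case number, in $\varepsilon$ or in $\rho$ are not $G^\sim$-equivalent. -/

import Mathlib

open Set
open scoped ContDiff

noncomputable section

namespace FKdV

/-- An equation `u_t + u^n u_x + α(t) u + β(t) u_xxxxx = 0` of the class (for a fixed exponent `n`):
its coefficients `α`, `β` are smooth functions on a nonempty open interval `I` of the variable `t`,
and `β` does not vanish on `I`.  Values of `α`, `β` outside `I` are irrelevant. -/
structure Equation where
  I : Set ℝ
  isOpen_I : IsOpen I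
  ordConnected_I : I.OrdConnected
  nonempty_I : I.Nonempty
  α : ℝ → ℝ
  β : ℝ → ℝ
  smooth_α : ContDiffOn ℝ ∞ α I
  smooth_β : ContDiffOn ℝ ∞ β I
  β_ne_zero : ∀ t ∈ I, β t ≠ 0

/-! ### The fifth-order jet space and the differential function of an equation -/

/-- Orders `(i, j)` of the derivatives `∂_t^i ∂_x^j u` with `i + j ≤ 5`. -/
abbrev Order5 : Type := {J : Fin 6 × Fin 6 // (J.1 : ℕ) + (J.2 : ℕ) ≤ 5}

/-- The fifth-order jet space with independent variables `(t, x)` and dependent variable `u`: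
a point is `(t, x, (u_J)_J)`. -/
abbrev Jet5 : Type := ℝ × ℝ × (Order5 → ℝ)

/-- The differential function `u_t + u^n u_x + α(t) u + β(t) u_xxxxx` on the jet space. -/
def Equation.lhs (n : ℝ) (E : Equation) (j : Jet5) : ℝ :=
  j.2.2 ⟨(1, 0), by decide⟩
    + j.2.2 ⟨(0, 0), by decide⟩ ^ n * j.2.2 ⟨(0, 1), by decide⟩
    + E.α j.1 * j.2.2 ⟨(0, 0), by decide⟩
    + E.β j.1 * j.2.2 ⟨(0, 5), by decide⟩

/-- The partial derivative `∂_t^i ∂_x^j f` of a function `f(t, x)`. -/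
def pderiv (i j : ℕ) (f : ℝ → ℝ → ℝ) (t x : ℝ) : ℝ :=
  iteratedDeriv i (fun s => iteratedDeriv j (f s) x) t

/-- The fifth-order jet of the function `u(t, x)` at the point `(t, x)`. -/
def jet5 (u : ℝ → ℝ → ℝ) (t x : ℝ) : Jet5 :=
  (t, x, fun J => pderiv (J.1.1 : ℕ) (J.1.2 : ℕ) u t x)

/-! ### Vector fields, prolongation, infinitesimal invariance -/

/-- A vector field `Q = τ ∂_t + ξ ∂_x + η ∂_u` on the space of the variables `(t, x, u)`,
written as `(t, x, u) ↦ (τ, ξ, η)`. -/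
abbrev VField : Type := ℝ × ℝ × ℝ → ℝ × ℝ × ℝ

/-- The characteristic `η - τ u_t - ξ u_x` of `Q`, along the function `u(t, x)`. -/
def characteristic (Q : VField) (u : ℝ → ℝ → ℝ) (t x : ℝ) : ℝ :=
  (Q (t, x, u t x)).2.2
    - (Q (t, x, u t x)).1 * pderiv 1 0 u t x
    - (Q (t, x, u t x)).2.1 * pderiv 0 1 u t x

/-- The value at the fifth-order jet of `u` at `(t, x)` of the fifth prolongation
`Q^(5) = τ ∂_t + ξ ∂_x + ∑_J η^J ∂_{u_J}`, with the standard coefficients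
`η^J = D_J (η - τ u_t - ξ u_x) + τ u_{J,t} + ξ u_{J,x}`, where the total derivative `D_J` is
computed along `u` as the partial derivative `∂_J`. -/
def prolong5 (Q : VField) (u : ℝ → ℝ → ℝ) (t x : ℝ) : Jet5 :=
  ((Q (t, x, u t x)).1, (Q (t, x, u t x)).2.1, fun J =>
    pderiv (J.1.1 : ℕ) (J.1.2 : ℕ) (characteristic Q u) t x
      + (Q (t, x, u t x)).1 * pderiv ((J.1.1 : ℕ) + 1) (J.1.2 : ℕ) u t x
      + (Q (t, x, u t x)).2.1 * pderiv (J.1.1 : ℕ) ((J.1.2 : ℕ) + 1) u t x)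

/-- The domain `I × ℝ × U` of the variables `(t, x, u)`, where `U` is the range of values
allowed for the dependent variable `u`. -/
def dom (I U : Set ℝ) : Set (ℝ × ℝ × ℝ) := I ×ˢ ((univ : Set ℝ) ×ˢ U)

/-- The maximal Lie invariance algebra `A^max` of an equation: all smooth vector fields `Q` on
`I × ℝ × U` (represented by their extension by zero) such that `Q^(5)` annihilates the left-hand
side of the equation at each fifth-order jet at which the equation holds. -/
def Amax (n : ℝ) (U : Set ℝ) (E : Equation) : Set VField :=
  {Q | ContDiffOn ℝ ∞ Q (dom E.I U) ∧ (∀ p, p ∉ dom E.I U → Q p = 0) ∧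
    ∀ u : ℝ → ℝ → ℝ, ContDiff ℝ ∞ (fun p : ℝ × ℝ => u p.1 p.2) →
      ∀ t x : ℝ, t ∈ E.I → u t x ∈ U →
        E.lhs n (jet5 u t x) = 0 →
          fderiv ℝ (E.lhs n) (jet5 u t x) (prolong5 Q u t x) = 0}

/-- The restriction of a vector field to `D` (extended by zero outside `D`). -/
def restrict (D : Set (ℝ × ℝ × ℝ)) (V : VField) : VField := D.indicator V

/-- The vector fields `v i`, restricted to `D`, form a basis of the space `A` of vector fields. -/
def IsBasisOn {k : ℕ} (D : Set (ℝ × ℝ × ℝ)) (v : Fin k → VField) (A : Set VField) : Prop :=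
  LinearIndependent ℝ (fun i => restrict D (v i)) ∧
    A = (Submodule.span ℝ (range fun i => restrict D (v i)) : Set VField)

/-- The vector field `∂_x`. -/
def dX : VField := fun _ => (0, 1, 0)

/-- The algebra `A^max` of the equation is nothing but `⟨∂_x⟩`. -/
def HasTrivialAmax (n : ℝ) (U : Set ℝ) (E : Equation) : Prop :=
  IsBasisOn (dom E.I U) ![dX] (Amax n U E)

/-! ### The equivalence group `G^∼` -/

/-- Parameters of a transformation from `G^∼`, considered over the interval `I`: a smooth function
`T` on `I` and constants `δ₁`, `δ₂` with `δ₁ T_t > 0`. -/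
structure EquivTransf (I : Set ℝ) where
  T : ℝ → ℝ
  δ₁ : ℝ
  δ₂ : ℝ
  smooth_T : ContDiffOn ℝ ∞ T I
  pos : ∀ t ∈ I, 0 < δ₁ * deriv T t

/-- The action on the variables:
`(t, x, u) ↦ (T(t), δ₁ x + δ₂, (δ₁ / T_t)^(1/n) u)`. -/
def EquivTransf.toFun {I : Set ℝ} (n : ℝ) (g : EquivTransf I) (p : ℝ × ℝ × ℝ) : ℝ × ℝ × ℝ :=
  (g.T p.1, g.δ₁ * p.2.1 + g.δ₂, (g.δ₁ / deriv g.T p.1) ^ (1 / n) * p.2.2)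

/-- The transformation `g` maps the equation `E` to the equation `E'`; the coefficients transform
as `α'(T(t)) = α / T_t + T_tt / (n T_t²)`, `β'(T(t)) = (δ₁⁵ / T_t) β`. -/
def EquivTransf.Maps (n : ℝ) (E E' : Equation) (g : EquivTransf E.I) : Prop :=
  E'.I = g.T '' E.I ∧
    ∀ t ∈ E.I,
      E'.α (g.T t) = E.α t / deriv g.T t + deriv (deriv g.T) t / (n * deriv g.T t ^ 2) ∧
      E'.β (g.T t) = g.δ₁ ^ 5 / deriv g.T t * E.β t

/-- `G^∼`-equivalence of two equations of the class. -/
def GEquiv (n : ℝ) (E E' : Equation) : Prop :=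
  ∃ g : EquivTransf E.I, g.Maps n E E'

/-! ### The classification list -/

/-- The cases of Lie symmetry extension: `β = ε t^ρ` with `ρ ≠ 0`, `β = ε e^t` and `β = ε`, where
`ε = ±1`. -/
inductive Case : Type
  | power (ε : ℤˣ) (ρ : ℝ) (hρ : ρ ≠ 0)
  | exp (ε : ℤˣ)
  | const (ε : ℤˣ)

/-- The values of `t` for which the case is considered: `t > 0` for `β = ε t^ρ`. -/
def Case.tDomain : Case → Set ℝ
  | .power _ _ _ => Ioi 0
  | .exp _ => univ
  | .const _ => univ

/-- The coefficient `β(t)`. -/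
def Case.β : Case → ℝ → ℝ
  | .power ε ρ _ => fun t => ((ε : ℤ) : ℝ) * t ^ ρ
  | .exp ε => fun t => ((ε : ℤ) : ℝ) * Real.exp t
  | .const ε => fun _ => ((ε : ℤ) : ℝ)

/-- The dimension of the algebra listed for the case. -/
def Case.dim : Case → ℕ
  | .power _ _ _ => 2
  | .exp _ => 2
  | .const _ => 3

/-- The basis operators listed for the case:
* `∂_x`, `5nt ∂_t + (ρ+1)nx ∂_x + (ρ-4)u ∂_u`;
* `∂_x`, `5n ∂_t + nx ∂_x + u ∂_u`;
* `∂_x`, `∂_t`, `5nt ∂_t + nx ∂_x - 4u ∂_u`. -/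
def Case.basis (n : ℝ) : (c : Case) → Fin c.dim → VField
  | .power _ ρ _ =>
    ![dX, fun p => (5 * n * p.1, (ρ + 1) * n * p.2.1, (ρ - 4) * p.2.2)]
  | .exp _ =>
    ![dX, fun p => (5 * n, n * p.2.1, p.2.2)]
  | .const _ =>
    ![dX, fun _ => (1, 0, 0), fun p => (5 * n * p.1, n * p.2.1, -4 * p.2.2)]

/-- `E` is the equation `u_t + u^n u_x + β(t) u_xxxxx = 0` with `β` as in the case `c`, on some open
interval of admissible values of `t`. -/
def IsRepresentative (c : Case) (E : Equation) : Prop :=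
  E.I ⊆ c.tDomain ∧ ∀ t ∈ E.I, E.α t = 0 ∧ E.β t = c.β t

end FKdV

end

noncomputable section

namespace FKdV

/-! The proof is Lie's infinitesimal method with explicit test functions. At a point with `u = A`,
take the jet with `u_x = m`, `u_xxxx = a`, `u_xxxxx = b`, `u_txxxx = e`, `u_xx = u_xxx = 0`, and
`u_t = q` fixed by the equation. Invariance on such jets is `determining_identity`. Varying `e`,
then `b`, then `a` shows that `τ = τ(t)`, that `ξ` is affine in `x` with slope `κ = (τβ)_t / (5β)`
and free of `u`, and that `η` is affine in `u` with a slope depending on `t` alone. Varying `m`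
leaves a relation between `u^n`, `u^(n-1)` and `1`. These are linearly independent because `n ≠ 0,
1`, so `ξ_t = 0`, `κ` is a constant `c`, and `η = ((c - τ_t)/n) u`. What survives is `IsSym`:
`(τβ)_t = 5cβ` and `(τα)_t = τ_tt / n`. Conversely every such field is a symmetry, so `mem_Amax_iff`
turns the classification into a question about this pair of equations in one variable.

Under `G^∼` the function `τ` transforms as a vector field on the line, `τβ` is multiplied by a
constant, and `τα - τ_t/n` is invariant. Differentiating these two relations gives the equivalence
of `IsSym` for the two equations (`isSym_iff_of_transport`), and the Jacobian of the point
transformation then identifies the algebras (`Amax_eq_image`).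

The choice `T_t = exp(-n ∫ α)` achieves `α = 0`. Then `τ = at + b` and `(at + b) β_t = (5c - a) β`.
If some such `τ` is not identically zero, `β` is a multiple of a constant, an exponential, or a
power of an affine function; an affine change of `t` and the choice of `δ₁` normalize it
(`exists_case_of_gauge`). If no such `τ` exists, then `c = 0` too and only `∂_x` remains.

Between two gauged equations `T` is affine and `β` changes by a positive factor, so the sign of `β`
and, up to an affine substitution, its logarithmic derivative are preserved. This separates the
cases (`IsRepresentative.case_eq`). -/

theorem natCast_le_infty (k : ℕ) : (k : WithTop ℕ∞) ≤ ∞ := by exact_mod_cast le_top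

/-! ### Directional derivatives of functions on the plane -/

/-- The derivative of `H` in the direction `v`. -/
def dirDeriv (v : ℝ × ℝ) (H : ℝ × ℝ → ℝ) : ℝ × ℝ → ℝ := fun q => fderiv ℝ H q v

theorem contDiffOn_dirDeriv {S : Set (ℝ × ℝ)} (hS : IsOpen S) {H : ℝ × ℝ → ℝ}
    (hH : ContDiffOn ℝ ∞ H S) (v : ℝ × ℝ) : ContDiffOn ℝ ∞ (dirDeriv v H) S :=
  (hH.fderiv_of_isOpen hS (by simp)).clm_apply contDiffOn_const

theorem dirDeriv_comm {S : Set (ℝ × ℝ)} (hS : IsOpen S) {H : ℝ × ℝ → ℝ}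
    (hH : ContDiffOn ℝ ∞ H S) (v w : ℝ × ℝ) {q : ℝ × ℝ} (hq : q ∈ S) :
    dirDeriv v (dirDeriv w H) q = dirDeriv w (dirDeriv v H) q := by
  have hc : ContDiffAt ℝ ∞ H q := hH.contDiffAt (hS.mem_nhds hq)
  have hd : DifferentiableAt ℝ (fderiv ℝ H) q :=
    ((hH.fderiv_of_isOpen hS (m := ∞) (by simp)).contDiffAt (hS.mem_nhds hq)).differentiableAt
      (by simp)
  have hs : IsSymmSndFDerivAt ℝ H q := hc.isSymmSndFDerivAt (by simpa using natCast_le_infty 2)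
  have key : ∀ v w, dirDeriv v (dirDeriv w H) q = fderiv ℝ (fderiv ℝ H) q v w := by
    intro v w
    change fderiv ℝ (fun p => fderiv ℝ H p w) q v = _
    rw [fderiv_clm_apply hd (differentiableAt_const w)]
    simp
  rw [key, key]
  exact hs v w

theorem hasDerivAt_comp_curve {S : Set (ℝ × ℝ)} (hS : IsOpen S) {H : ℝ × ℝ → ℝ}
    (hH : ContDiffOn ℝ ∞ H S) {a b : ℝ → ℝ} {a' b' x : ℝ} (ha : HasDerivAt a a' x)
    (hb : HasDerivAt b b' x) (hx : (a x, b x) ∈ S) :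
    HasDerivAt (fun s => H (a s, b s)) (dirDeriv (a', b') H (a x, b x)) x := by
  have hd : DifferentiableAt ℝ H (a x, b x) :=
    (hH.contDiffAt (hS.mem_nhds hx)).differentiableAt (by simp)
  exact hd.hasFDerivAt.comp_hasDerivAt x (ha.prodMk hb)

theorem dirDeriv_add_smul (H : ℝ × ℝ → ℝ) (q : ℝ × ℝ) (a m r : ℝ) :
    dirDeriv (a, m + r) H q = dirDeriv (a, m) H q + dirDeriv (0, 1) H q * r := by
  have h : ((a, m + r) : ℝ × ℝ) = (a, m) + r • (0, 1) := by simp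
  simp only [dirDeriv, h, map_add, map_smul, smul_eq_mul]
  ring

/-! ### Derivatives along perturbed lines -/

section Perturbation

variable {S : Set (ℝ × ℝ)} {H : ℝ × ℝ → ℝ} {x₀ A m : ℝ} {r : ℝ → ℝ}

theorem contDiffAt_comp_perturbed (hS : IsOpen S) (hH : ContDiffOn ℝ ∞ H S)
    (hA : (x₀, A) ∈ S) (hr : ContDiff ℝ ∞ r) (hr0 : r x₀ = 0) :
    ContDiffAt ℝ ∞ (fun x => H (x, A + m * (x - x₀) + r x)) x₀ := by
  have h : ContDiffAt ℝ ∞ H (x₀, A + m * (x₀ - x₀) + r x₀) :=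
    hH.contDiffAt (hS.mem_nhds (by simpa [hr0] using hA))
  exact ContDiffAt.comp x₀ (g := H) (f := fun x => (x, A + m * (x - x₀) + r x)) h
    (ContDiff.contDiffAt (by fun_prop))

theorem deriv_comp_perturbed (hS : IsOpen S) (hH : ContDiffOn ℝ ∞ H S)
    (hA : (x₀, A) ∈ S) (hr : ContDiff ℝ ∞ r) (hr0 : r x₀ = 0) :
    deriv (fun x => H (x, A + m * (x - x₀) + r x)) =ᶠ[nhds x₀]
      fun x => dirDeriv (1, m) H (x, A + m * (x - x₀) + r x)
        + dirDeriv (0, 1) H (x, A + m * (x - x₀) + r x) * deriv r x := by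
  have hc : Continuous fun x : ℝ => (x, A + m * (x - x₀) + r x) := by fun_prop
  have hmem : ∀ᶠ x in nhds x₀, (x, A + m * (x - x₀) + r x) ∈ S :=
    hc.continuousAt.eventually_mem (hS.mem_nhds (by simpa [hr0] using hA))
  filter_upwards [hmem] with x hx
  have hrd : HasDerivAt r (deriv r x) x := (hr.differentiable (by simp) x).hasDerivAt
  have hb : HasDerivAt (fun x => A + m * (x - x₀) + r x) (m + deriv r x) x := by
    have h := ((((hasDerivAt_id x).sub_const x₀).const_mul m).const_add A).add hrd
    rw [mul_one] at h
    exact h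
  rw [← dirDeriv_add_smul]
  exact (hasDerivAt_comp_curve hS hH (hasDerivAt_id x) hb hx).deriv

/-- The chain rule gives `D_(1,m) H + H_u r'` along the curve, and Leibniz expands the second term.
As the right side has the same shape with one order less, the higher chain rules below follow by
recursion. -/
theorem iteratedDeriv_succ_comp_perturbed (hS : IsOpen S) (hH : ContDiffOn ℝ ∞ H S)
    (hA : (x₀, A) ∈ S) (hr : ContDiff ℝ ∞ r) (hr0 : r x₀ = 0) (k : ℕ) :
    iteratedDeriv (k + 1) (fun x => H (x, A + m * (x - x₀) + r x)) x₀ =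
      iteratedDeriv k (fun x => dirDeriv (1, m) H (x, A + m * (x - x₀) + r x)) x₀
      + ∑ i ∈ Finset.range (k + 1), (k.choose i : ℝ)
        * iteratedDeriv i (fun x => dirDeriv (0, 1) H (x, A + m * (x - x₀) + r x)) x₀
        * iteratedDeriv (k - i + 1) r x₀ := by
  have h1 := contDiffAt_comp_perturbed (m := m) hS (contDiffOn_dirDeriv hS hH (1, m)) hA hr hr0
  have h2 := contDiffAt_comp_perturbed (m := m) hS (contDiffOn_dirDeriv hS hH (0, 1)) hA hr hr0
  have h3 : ContDiff ℝ ∞ (deriv r) := (contDiff_infty_iff_deriv.1 hr).2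
  have hk := natCast_le_infty k
  rw [iteratedDeriv_succ', (deriv_comp_perturbed hS hH hA hr hr0).iteratedDeriv_eq,
    iteratedDeriv_fun_add (h1.of_le hk) ((h2.mul h3.contDiffAt).of_le hk),
    iteratedDeriv_fun_mul (h2.of_le hk) (h3.contDiffAt.of_le hk)]
  simp only [iteratedDeriv_succ']

theorem iteratedDeriv_comp_perturbed_of_flat (hS : IsOpen S) (hH : ContDiffOn ℝ ∞ H S)
    (hA : (x₀, A) ∈ S) (hr : ContDiff ℝ ∞ r) (k : ℕ)
    (hr0 : ∀ j ≤ k, iteratedDeriv j r x₀ = 0) :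
    iteratedDeriv k (fun x => H (x, A + m * (x - x₀) + r x)) x₀ =
      (dirDeriv (1, m))^[k] H (x₀, A) := by
  have hz : r x₀ = 0 := by simpa using hr0 0 (Nat.zero_le _)
  induction k generalizing H with
  | zero => simp [hz]
  | succ k ih =>
    rw [iteratedDeriv_succ_comp_perturbed hS hH hA hr hz, Finset.sum_eq_zero, add_zero,
      ih (contDiffOn_dirDeriv hS hH _) fun j hj => hr0 j (hj.trans k.le_succ),
      Function.iterate_succ_apply]
    intro i hi
    rw [hr0 _ (by omega), mul_zero]

theorem iteratedDeriv_comp_line (hS : IsOpen S) (hH : ContDiffOn ℝ ∞ H S)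
    (hA : (x₀, A) ∈ S) (m : ℝ) (k : ℕ) :
    iteratedDeriv k (fun x => H (x, A + m * (x - x₀))) x₀ =
      (dirDeriv (1, m))^[k] H (x₀, A) := by
  simpa using iteratedDeriv_comp_perturbed_of_flat (r := fun _ => 0) (m := m) hS hH hA
    contDiff_const k (by simp)

theorem iteratedDeriv_four_comp_perturbed (hS : IsOpen S) (hH : ContDiffOn ℝ ∞ H S)
    (hA : (x₀, A) ∈ S) (hr : ContDiff ℝ ∞ r) (hr0 : ∀ j ≤ 3, iteratedDeriv j r x₀ = 0) :
    iteratedDeriv 4 (fun x => H (x, A + m * (x - x₀) + r x)) x₀ =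
      (dirDeriv (1, m))^[4] H (x₀, A) + dirDeriv (0, 1) H (x₀, A) * iteratedDeriv 4 r x₀ := by
  have hz : r x₀ = 0 := by simpa using hr0 0 (by norm_num)
  rw [iteratedDeriv_succ_comp_perturbed hS hH hA hr hz,
    iteratedDeriv_comp_perturbed_of_flat hS (contDiffOn_dirDeriv hS hH _) hA hr 3 hr0]
  simp [Finset.sum_range_succ, hr0, hz]

/-- Since `r` vanishes to order three, products of derivatives of `r` do not appear up to order
five. The mixed term gets `1` from the order-four formula for `D_(1,m) H` and `4` from Leibniz,
hence the factor `5`. -/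
theorem iteratedDeriv_five_comp_perturbed (hS : IsOpen S) (hH : ContDiffOn ℝ ∞ H S)
    (hA : (x₀, A) ∈ S) (hr : ContDiff ℝ ∞ r) (hr0 : ∀ j ≤ 3, iteratedDeriv j r x₀ = 0) :
    iteratedDeriv 5 (fun x => H (x, A + m * (x - x₀) + r x)) x₀ =
      (dirDeriv (1, m))^[5] H (x₀, A)
      + 5 * dirDeriv (1, m) (dirDeriv (0, 1) H) (x₀, A) * iteratedDeriv 4 r x₀
      + dirDeriv (0, 1) H (x₀, A) * iteratedDeriv 5 r x₀ := by
  have hz : r x₀ = 0 := by simpa using hr0 0 (by norm_num)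
  have h1 := iteratedDeriv_comp_perturbed_of_flat (m := m) hS (contDiffOn_dirDeriv hS hH (0, 1))
    hA hr 1 fun j hj => hr0 j (by omega)
  rw [iteratedDeriv_succ_comp_perturbed hS hH hA hr hz,
    iteratedDeriv_four_comp_perturbed hS (contDiffOn_dirDeriv hS hH _) hA hr hr0,
    dirDeriv_comm hS hH (0, 1) (1, m) hA]
  simp only [Finset.sum_range_succ, Finset.sum_range_zero, h1]
  simp [hr0, hz]
  ring

/-- Flatness of `w` is asked only to order two, so that `w = r'` is allowed. The factors `10` and
`5` are the binomial coefficients of the surviving Leibniz terms, in which `H` is differentiated at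
most twice and so does not yet feel `r`. -/
theorem iteratedDeriv_five_comp_perturbed_mul (hS : IsOpen S) (hH : ContDiffOn ℝ ∞ H S)
    (hA : (x₀, A) ∈ S) (hr : ContDiff ℝ ∞ r) (hr0 : ∀ j ≤ 3, iteratedDeriv j r x₀ = 0)
    {w : ℝ → ℝ} (hw : ContDiff ℝ ∞ w) (hw0 : ∀ j ≤ 2, iteratedDeriv j w x₀ = 0) (b : ℝ) :
    iteratedDeriv 5 (fun x => H (x, A + m * (x - x₀) + r x) * (b + w x)) x₀ =
      b * iteratedDeriv 5 (fun x => H (x, A + m * (x - x₀) + r x)) x₀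
      + 10 * (dirDeriv (1, m))^[2] H (x₀, A) * iteratedDeriv 3 w x₀
      + 5 * dirDeriv (1, m) H (x₀, A) * iteratedDeriv 4 w x₀
      + H (x₀, A) * iteratedDeriv 5 w x₀ := by
  have hz : r x₀ = 0 := by simpa using hr0 0 (by norm_num)
  have h1 := contDiffAt_comp_perturbed (m := m) hS hH hA hr hz
  have h3 : ContDiffAt ℝ ∞ w x₀ := hw.contDiffAt
  have h5 := natCast_le_infty 5
  have hs : (fun x => H (x, A + m * (x - x₀) + r x) * (b + w x)) = fun x =>
      b * H (x, A + m * (x - x₀) + r x) + H (x, A + m * (x - x₀) + r x) * w x := by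
    funext x; ring
  have e1 := iteratedDeriv_comp_perturbed_of_flat (m := m) hS hH hA hr 1
    fun j hj => hr0 j (by omega)
  have e2 := iteratedDeriv_comp_perturbed_of_flat (m := m) hS hH hA hr 2
    fun j hj => hr0 j (by omega)
  rw [hs, iteratedDeriv_fun_add ((contDiffAt_const.mul h1).of_le h5) ((h1.mul h3).of_le h5),
    iteratedDeriv_fun_mul (h1.of_le h5) (h3.of_le h5), iteratedDeriv_const_mul_field, add_assoc,
    add_assoc]
  simp only [Finset.sum_range_succ, Finset.sum_range_zero, e1, e2]
  simp [hw0, hz, Nat.choose]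
  ring

end Perturbation

/-- A function whose derivative in every direction `(1, m)` is `κ` grows with the slope `κ` in the
first variable, and does not depend on the second one. -/
theorem eq_add_of_dirDeriv_eq {U : Set ℝ} (hUo : IsOpen U) (hUc : Convex ℝ U) {K : ℝ × ℝ → ℝ}
    (hK : ContDiffOn ℝ ∞ K (univ ×ˢ U)) {κ : ℝ}
    (h : ∀ q ∈ (univ : Set ℝ) ×ˢ U, ∀ m, dirDeriv (1, m) K q = κ) {x y A B : ℝ}
    (hA : A ∈ U) (hB : B ∈ U) : K (y, B) = K (x, A) + κ * (y - x) := by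
  have hS : IsOpen ((univ : Set ℝ) ×ˢ U) := isOpen_univ.prod hUo
  have hdir : ∀ q ∈ (univ : Set ℝ) ×ˢ U, ∀ a b, dirDeriv (a, b) K q = a * κ := by
    intro q hq a b
    have h0 := h q hq 0
    have h1 := h q hq 1
    -- Slopes `0` and `1` already give two independent directions, hence the whole gradient of `K`.
    have hv : ((a, b) : ℝ × ℝ) = (a - b) • (1, 0) + b • (1, 1) := by simp
    simp only [dirDeriv] at h0 h1 ⊢
    rw [hv, map_add, map_smul, map_smul, h0, h1]
    simp only [smul_eq_mul]
    ring
  have hmem : ∀ s ∈ Icc (0 : ℝ) 1, (x + s * (y - x), A + s * (B - A)) ∈ (univ : Set ℝ) ×ˢ U :=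
    fun s hs => ⟨mem_univ _, by simpa using hUc.add_smul_sub_mem hA hB hs⟩
  have hd : ∀ s ∈ Icc (0 : ℝ) 1,
      HasDerivAt (fun s => K (x + s * (y - x), A + s * (B - A))) ((y - x) * κ) s := by
    intro s hs
    rw [← hdir _ (hmem s hs) (y - x) (B - A)]
    have ha : HasDerivAt (fun s => x + s * (y - x)) (y - x) s := by
      simpa using ((hasDerivAt_id s).mul_const (y - x)).const_add x
    have hb : HasDerivAt (fun s => A + s * (B - A)) (B - A) s := by
      simpa using ((hasDerivAt_id s).mul_const (B - A)).const_add A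
    exact hasDerivAt_comp_curve hS hK ha hb (hmem s hs)
  obtain ⟨c, -, hc⟩ := exists_hasDerivAt_eq_slope
    (fun s => K (x + s * (y - x), A + s * (B - A))) (fun _ => (y - x) * κ) zero_lt_one
    (fun s hs => (hd s hs).continuousAt.continuousWithinAt)
    fun s hs => hd s (Ioo_subset_Icc_self hs)
  simp at hc
  linarith

/-! ### Admissible exponents -/

/-- The properties of the exponent `n` and of the range `U` of the dependent variable on which the
classification depends. -/
structure Admissible (n : ℝ) (U : Set ℝ) : Prop where
  isOpen : IsOpen U
  convex : Convex ℝ U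
  pos_mem : ∀ a, 0 < a → a ∈ U
  mul_mem : ∀ s, 0 < s → ∀ a ∈ U, s * a ∈ U
  ne_zero : n ≠ 0
  ne_one : n ≠ 1
  hasDerivAt : ∀ a ∈ U, HasDerivAt (fun v : ℝ => v ^ n) (n * a ^ (n - 1)) a
  mul_self : ∀ a ∈ U, a ^ (n - 1) * a = a ^ n

theorem admissible_of {n : ℝ} {U : Set ℝ}
    (hU : (U = Set.univ ∧ ∃ k : ℕ, 2 ≤ k ∧ n = k) ∨ (U = Set.Ioi 0 ∧ n ≠ 0 ∧ n ≠ 1)) :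
    Admissible n U := by
  rcases hU with ⟨rfl, k, hk, rfl⟩ | ⟨rfl, h0, h1⟩
  · have hk' : (2 : ℝ) ≤ k := by exact_mod_cast hk
    refine ⟨isOpen_univ, convex_univ, fun _ _ => mem_univ _, fun _ _ _ _ => mem_univ _,
      by linarith, by linarith, fun a _ => Real.hasDerivAt_rpow_const (Or.inr (by linarith)),
      fun a _ => ?_⟩
    rcases eq_or_ne a 0 with rfl | ha
    · rw [mul_zero, Real.zero_rpow (by linarith)]
    · rw [Real.rpow_sub_one ha, div_mul_cancel₀ _ ha]
  · refine ⟨isOpen_Ioi, convex_Ioi 0, fun _ h => h, fun s hs a ha => mul_pos hs ha, h0, h1,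
      fun a ha => Real.hasDerivAt_rpow_const (Or.inl (ne_of_gt ha)), fun a ha => ?_⟩
    rw [Real.rpow_sub_one (ne_of_gt ha), div_mul_cancel₀ _ (ne_of_gt ha)]

/-- The functions `v ^ n`, `v ^ (n - 1)` and `1` are linearly independent. -/
theorem Admissible.linearIndependent {n : ℝ} {U : Set ℝ} (h : Admissible n U) {a b c : ℝ}
    (habc : ∀ v ∈ U, a * v ^ n + b * v ^ (n - 1) + c = 0) : a = 0 ∧ b = 0 ∧ c = 0 := by
  -- With `X = 2 ^ n`, the values at `1, 2, 4` form a Vandermonde system with nodes `X`, `X / 2`,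
  -- `1`, which are distinct exactly when `X ≠ 0, 1, 2`.
  have e1 := habc 1 (h.pos_mem 1 one_pos)
  have e2 := habc 2 (h.pos_mem 2 two_pos)
  have e4 := habc 4 (h.pos_mem 4 (by norm_num))
  have h4 : (4 : ℝ) ^ n = 2 ^ n * 2 ^ n := by
    rw [← Real.mul_rpow (by norm_num) (by norm_num)]; norm_num
  rw [Real.rpow_sub_one (by norm_num), h4] at e4
  rw [Real.rpow_sub_one (by norm_num)] at e2
  simp only [Real.one_rpow] at e1
  have hX0 : (2 : ℝ) ^ n ≠ 0 := by positivity
  have hX1 : (2 : ℝ) ^ n ≠ 1 := by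
    intro hX
    have := (Real.rpow_right_inj (x := 2) two_pos (by norm_num)).1
      (hX.trans (Real.rpow_zero 2).symm)
    exact h.ne_zero this
  have hX2 : (2 : ℝ) ^ n ≠ 2 := by
    intro hX
    have := (Real.rpow_right_inj (x := 2) two_pos (by norm_num)).1
      (hX.trans (Real.rpow_one 2).symm)
    exact h.ne_one this
  generalize (2 : ℝ) ^ n = X at *
  -- The weights come from the polynomial `(z - 1)(z - X)`, which kills the nodes of `a` and `c`.
  have hb : b * (X * (X - 2)) = 0 := by linear_combination 4 * e4 * (-1) + 4 * (X + 1) * e2 - 4 * X * e1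
  have hb0 : b = 0 := by
    rcases mul_eq_zero.1 hb with hb | hb
    · exact hb
    · rcases mul_eq_zero.1 hb with hb | hb
      · exact absurd hb hX0
      · exact absurd (sub_eq_zero.1 hb) hX2
  subst hb0
  have ha : a * (X - 1) = 0 := by linear_combination e2 - e1
  have ha0 : a = 0 := (mul_eq_zero.1 ha).resolve_right (sub_ne_zero.2 hX1)
  subst ha0
  exact ⟨rfl, rfl, by linarith⟩

/-! ### The derivative of the left-hand side -/

theorem Equation.hasDerivAt_α (E : Equation) {t : ℝ} (ht : t ∈ E.I) :
    HasDerivAt E.α (deriv E.α t) t :=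
  ((E.smooth_α.contDiffAt (E.isOpen_I.mem_nhds ht)).differentiableAt (by simp)).hasDerivAt

theorem Equation.hasDerivAt_β (E : Equation) {t : ℝ} (ht : t ∈ E.I) :
    HasDerivAt E.β (deriv E.β t) t :=
  ((E.smooth_β.contDiffAt (E.isOpen_I.mem_nhds ht)).differentiableAt (by simp)).hasDerivAt

theorem fderiv_lhs {n : ℝ} {U : Set ℝ} (h : Admissible n U) (E : Equation) (j v : Jet5)
    (ht : j.1 ∈ E.I) (hu : j.2.2 ⟨(0, 0), by decide⟩ ∈ U) :
    fderiv ℝ (E.lhs n) j v =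
      v.2.2 ⟨(1, 0), by decide⟩
      + (j.2.2 ⟨(0, 0), by decide⟩ ^ n * v.2.2 ⟨(0, 1), by decide⟩
        + n * j.2.2 ⟨(0, 0), by decide⟩ ^ (n - 1) * v.2.2 ⟨(0, 0), by decide⟩
          * j.2.2 ⟨(0, 1), by decide⟩)
      + (E.α j.1 * v.2.2 ⟨(0, 0), by decide⟩
        + deriv E.α j.1 * v.1 * j.2.2 ⟨(0, 0), by decide⟩)
      + (E.β j.1 * v.2.2 ⟨(0, 5), by decide⟩
        + deriv E.β j.1 * v.1 * j.2.2 ⟨(0, 5), by decide⟩) := by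
  have hJ : ∀ J : Order5, HasFDerivAt (fun j : Jet5 => j.2.2 J)
      ((ContinuousLinearMap.proj J).comp ((ContinuousLinearMap.snd ℝ ℝ (Order5 → ℝ)).comp
        (ContinuousLinearMap.snd ℝ ℝ (ℝ × (Order5 → ℝ))))) j :=
    fun J => ((ContinuousLinearMap.proj J).comp ((ContinuousLinearMap.snd ℝ ℝ (Order5 → ℝ)).comp
      (ContinuousLinearMap.snd ℝ ℝ (ℝ × (Order5 → ℝ))))).hasFDerivAt
  have hT : HasFDerivAt (fun j : Jet5 => j.1) (ContinuousLinearMap.fst ℝ ℝ (ℝ × (Order5 → ℝ))) j :=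
    hasFDerivAt_fst
  have key := (((hJ ⟨(1, 0), by decide⟩).add
    (((h.hasDerivAt _ hu).comp_hasFDerivAt j (hJ ⟨(0, 0), by decide⟩)).mul
      (hJ ⟨(0, 1), by decide⟩))).add
    (((E.hasDerivAt_α ht).comp_hasFDerivAt j hT).mul (hJ ⟨(0, 0), by decide⟩))).add
    (((E.hasDerivAt_β ht).comp_hasFDerivAt j hT).mul (hJ ⟨(0, 5), by decide⟩))
  have e := key.fderiv
  change fderiv ℝ (E.lhs n) j = _ at e
  rw [e]
  simp
  ring

/-! ### Partial derivatives of smooth functions -/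

theorem iteratedDeriv_slice {F : ℝ × ℝ → ℝ} (hF : ContDiff ℝ ∞ F) (k : ℕ) (t x : ℝ) :
    iteratedDeriv k (fun y => F (t, y)) x = (dirDeriv (0, 1))^[k] F (t, x) := by
  induction k generalizing F with
  | zero => simp
  | succ k ih =>
    have hd : deriv (fun y => F (t, y)) = fun y => dirDeriv (0, 1) F (t, y) := by
      funext y
      exact (hasDerivAt_comp_curve isOpen_univ hF.contDiffOn (hasDerivAt_const y t)
        (hasDerivAt_id y) (mem_univ _)).deriv
    rw [iteratedDeriv_succ', hd, Function.iterate_succ_apply,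
      ih (contDiffOn_univ.1 (contDiffOn_dirDeriv isOpen_univ hF.contDiffOn _))]

theorem deriv_slice {F : ℝ × ℝ → ℝ} (hF : ContDiff ℝ ∞ F) (t x : ℝ) :
    deriv (fun s => F (s, x)) t = dirDeriv (1, 0) F (t, x) :=
  (hasDerivAt_comp_curve isOpen_univ hF.contDiffOn (hasDerivAt_id t)
    (hasDerivAt_const t x) (mem_univ _)).deriv

theorem contDiff_dirDeriv {F : ℝ × ℝ → ℝ} (hF : ContDiff ℝ ∞ F) (v : ℝ × ℝ) :
    ContDiff ℝ ∞ (dirDeriv v F) :=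
  contDiffOn_univ.1 (contDiffOn_dirDeriv isOpen_univ hF.contDiffOn v)

theorem contDiff_iterate_dirDeriv {F : ℝ × ℝ → ℝ} (hF : ContDiff ℝ ∞ F) (v : ℝ × ℝ) (k : ℕ) :
    ContDiff ℝ ∞ ((dirDeriv v)^[k] F) := by
  induction k generalizing F with
  | zero => exact hF
  | succ k ih => exact ih (contDiff_dirDeriv hF v)

theorem dirDeriv_iterate_comm {F : ℝ × ℝ → ℝ} (hF : ContDiff ℝ ∞ F) (v w : ℝ × ℝ) (k : ℕ) :
    dirDeriv v ((dirDeriv w)^[k] F) = (dirDeriv w)^[k] (dirDeriv v F) := by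
  induction k generalizing F with
  | zero => rfl
  | succ k ih =>
    rw [Function.iterate_succ_apply, Function.iterate_succ_apply, ih (contDiff_dirDeriv hF w)]
    congr 1
    funext q
    exact dirDeriv_comm isOpen_univ hF.contDiffOn v w (mem_univ q)

theorem pderiv_zero_eq {u : ℝ → ℝ → ℝ} (hu : ContDiff ℝ ∞ fun p : ℝ × ℝ => u p.1 p.2) (k : ℕ)
    (t x : ℝ) : pderiv 0 k u t x = (dirDeriv (0, 1))^[k] (fun p => u p.1 p.2) (t, x) := by
  rw [pderiv, iteratedDeriv_zero, ← iteratedDeriv_slice hu]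

theorem pderiv_one_eq {u : ℝ → ℝ → ℝ} (hu : ContDiff ℝ ∞ fun p : ℝ × ℝ => u p.1 p.2) (k : ℕ)
    (t x : ℝ) : pderiv 1 k u t x =
      (dirDeriv (0, 1))^[k] (dirDeriv (1, 0) fun p => u p.1 p.2) (t, x) := by
  rw [pderiv, iteratedDeriv_one, ← dirDeriv_iterate_comm hu,
    ← deriv_slice (contDiff_iterate_dirDeriv hu _ k)]
  congr 1
  funext s
  exact iteratedDeriv_slice hu k s x

theorem contDiff_pderiv_zero {u : ℝ → ℝ → ℝ} (hu : ContDiff ℝ ∞ fun p : ℝ × ℝ => u p.1 p.2)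
    (k : ℕ) : ContDiff ℝ ∞ fun p : ℝ × ℝ => pderiv 0 k u p.1 p.2 := by
  simp only [pderiv_zero_eq hu]
  exact contDiff_iterate_dirDeriv hu _ k

theorem contDiff_pderiv_one {u : ℝ → ℝ → ℝ} (hu : ContDiff ℝ ∞ fun p : ℝ × ℝ => u p.1 p.2)
    (k : ℕ) : ContDiff ℝ ∞ fun p : ℝ × ℝ => pderiv 1 k u p.1 p.2 := by
  simp only [pderiv_one_eq hu]
  exact contDiff_iterate_dirDeriv (contDiff_dirDeriv hu _) _ k

theorem iteratedDeriv_pderiv_zero {u : ℝ → ℝ → ℝ} (j k : ℕ) (t x : ℝ) :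
    iteratedDeriv k (pderiv 0 j u t) x = pderiv 0 (j + k) u t x := by
  have h : ∀ i, pderiv 0 i u t = deriv^[i] (u t) := fun i => by
    funext y
    rw [pderiv, iteratedDeriv_zero, iteratedDeriv_eq_iterate]
  rw [h, h, iteratedDeriv_eq_iterate, ← Function.iterate_add_apply, Nat.add_comm]

theorem iteratedDeriv_pderiv_one {u : ℝ → ℝ → ℝ}
    (hu : ContDiff ℝ ∞ fun p : ℝ × ℝ => u p.1 p.2) (k : ℕ) (t x : ℝ) :
    iteratedDeriv k (pderiv 1 0 u t) x = pderiv 1 k u t x := by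
  have h : pderiv 1 0 u t = fun y => dirDeriv (1, 0) (fun p => u p.1 p.2) (t, y) := by
    funext y
    rw [pderiv_one_eq hu]; rfl
  rw [h, iteratedDeriv_slice (contDiff_dirDeriv hu _), pderiv_one_eq hu]

/-! ### The infinitesimal invariance condition -/

theorem fderiv_lhs_prolong5 {n : ℝ} {U : Set ℝ} (h : Admissible n U) (E : Equation) (Q : VField)
    (u : ℝ → ℝ → ℝ) {t x : ℝ} (ht : t ∈ E.I) (hu : u t x ∈ U) :
    fderiv ℝ (E.lhs n) (jet5 u t x) (prolong5 Q u t x) =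
      (pderiv 1 0 (characteristic Q u) t x + (Q (t, x, u t x)).1 * pderiv 2 0 u t x
        + (Q (t, x, u t x)).2.1 * pderiv 1 1 u t x)
      + u t x ^ n * (pderiv 0 1 (characteristic Q u) t x + (Q (t, x, u t x)).1 * pderiv 1 1 u t x
        + (Q (t, x, u t x)).2.1 * pderiv 0 2 u t x)
      + n * u t x ^ (n - 1) * (Q (t, x, u t x)).2.2 * pderiv 0 1 u t x
      + (E.α t * (Q (t, x, u t x)).2.2 + deriv E.α t * (Q (t, x, u t x)).1 * u t x)
      + (E.β t * (pderiv 0 5 (characteristic Q u) t x + (Q (t, x, u t x)).1 * pderiv 1 5 u t x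
        + (Q (t, x, u t x)).2.1 * pderiv 0 6 u t x)
        + deriv E.β t * (Q (t, x, u t x)).1 * pderiv 0 5 u t x) := by
  have h0 : ∀ f : ℝ → ℝ → ℝ, pderiv 0 0 f t x = f t x := fun f => by simp [pderiv]
  rw [fderiv_lhs h E _ _ ht (by simpa [jet5, h0] using hu)]
  simp only [jet5, prolong5, Fin.val_zero, Fin.val_one, h0, characteristic, Fin.isValue,
    show ((5 : Fin 6) : ℕ) = 5 from rfl, zero_add, Nat.reduceAdd]
  ring

theorem lhs_jet5 (n : ℝ) (E : Equation) (u : ℝ → ℝ → ℝ) (t x : ℝ) :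
    E.lhs n (jet5 u t x) = pderiv 1 0 u t x + u t x ^ n * pderiv 0 1 u t x + E.α t * u t x
      + E.β t * pderiv 0 5 u t x := by
  have h0 : pderiv 0 0 u t x = u t x := by simp [pderiv]
  simp [Equation.lhs, jet5, h0]

theorem mem_dom {I U : Set ℝ} {t x u : ℝ} : (t, x, u) ∈ dom I U ↔ t ∈ I ∧ u ∈ U := by
  simp [dom]

/-! ### The symmetries of an equation -/

/-- The vector field `τ(t) ∂_t + (c x + d) ∂_x + ((c - τ'(t)) / n) u ∂_u` on `I × ℝ × U`. -/
def symField (n : ℝ) (I U : Set ℝ) (τ : ℝ → ℝ) (c d : ℝ) : VField :=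
  restrict (dom I U) fun p => (τ p.1, c * p.2.1 + d, (c - deriv τ p.1) / n * p.2.2)

/-- The solutions `(τ, c)` of the determining equations of the equation `E`. -/
structure IsSym (n : ℝ) (E : Equation) (τ : ℝ → ℝ) (c : ℝ) : Prop where
  smooth : ContDiffOn ℝ ∞ τ E.I
  eq_β : ∀ t ∈ E.I, deriv τ t * E.β t + τ t * deriv E.β t = 5 * c * E.β t
  eq_α : ∀ t ∈ E.I, deriv τ t * E.α t + τ t * deriv E.α t = deriv (deriv τ) t / n

theorem symField_apply {n : ℝ} {I U : Set ℝ} {τ : ℝ → ℝ} {c d t x u : ℝ} (ht : t ∈ I)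
    (hu : u ∈ U) :
    symField n I U τ c d (t, x, u) = (τ t, c * x + d, (c - deriv τ t) / n * u) := by
  rw [symField, restrict, Set.indicator_of_mem (mem_dom.2 ⟨ht, hu⟩)]

theorem symField_of_notMem {n : ℝ} {I U : Set ℝ} {τ : ℝ → ℝ} {c d : ℝ} {p : ℝ × ℝ × ℝ}
    (hp : p ∉ dom I U) : symField n I U τ c d p = 0 := by
  rw [symField, restrict, Set.indicator_of_notMem hp]

theorem contDiffOn_deriv {I : Set ℝ} (hI : IsOpen I) {τ : ℝ → ℝ} (h : ContDiffOn ℝ ∞ τ I) :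
    ContDiffOn ℝ ∞ (deriv τ) I :=
  ((contDiffOn_infty_iff_deriv_of_isOpen hI).1 h).2

theorem contDiffOn_symField {n : ℝ} {I U : Set ℝ} (hI : IsOpen I) {τ : ℝ → ℝ} {c d : ℝ}
    (h : ContDiffOn ℝ ∞ τ I) : ContDiffOn ℝ ∞ (symField n I U τ c d) (dom I U) := by
  have hm : MapsTo (fun p : ℝ × ℝ × ℝ => p.1) (dom I U) I := fun p hp => hp.1
  have h1 : ContDiffOn ℝ ∞ (fun p : ℝ × ℝ × ℝ => τ p.1) (dom I U) :=
    h.comp contDiff_fst.contDiffOn hm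
  have h2 : ContDiffOn ℝ ∞ (fun p : ℝ × ℝ × ℝ => deriv τ p.1) (dom I U) :=
    (contDiffOn_deriv hI h).comp contDiff_fst.contDiffOn hm
  refine ContDiffOn.congr (f := fun p : ℝ × ℝ × ℝ =>
    (τ p.1, c * p.2.1 + d, (c - deriv τ p.1) / n * p.2.2)) ?_
    fun p hp => by rw [symField, restrict, Set.indicator_of_mem hp]
  refine h1.prodMk (ContDiffOn.prodMk (ContDiff.contDiffOn (by fun_prop)) ?_)
  exact ((contDiffOn_const.sub h2).div_const n).mul (ContDiff.contDiffOn (by fun_prop))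

theorem iteratedDeriv_succ_affine_mul {f : ℝ → ℝ} (hf : ContDiff ℝ ∞ f) (c d : ℝ) (k : ℕ) (x : ℝ) :
    iteratedDeriv (k + 1) (fun y => (c * y + d) * f y) x =
      (c * x + d) * iteratedDeriv (k + 1) f x + (k + 1) * c * iteratedDeriv k f x := by
  induction k generalizing f with
  | zero =>
    have h : HasDerivAt (fun y => (c * y + d) * f y) (c * f x + (c * x + d) * deriv f x) x := by
      have h1 : HasDerivAt (fun y => c * y + d) c x := by
        simpa using ((hasDerivAt_id x).const_mul c).add_const d
      exact h1.mul (hf.differentiable (by simp) x).hasDerivAt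
    simp only [zero_add, iteratedDeriv_one, iteratedDeriv_zero, h.deriv]
    push_cast
    ring
  | succ k ih =>
    have h : deriv (fun y => (c * y + d) * f y) = fun y => c * f y + (c * y + d) * deriv f y := by
      funext y
      have h1 : HasDerivAt (fun y => c * y + d) c y := by
        simpa using ((hasDerivAt_id y).const_mul c).add_const d
      exact (h1.mul (hf.differentiable (by simp) y).hasDerivAt).deriv
    have hf' : ContDiff ℝ ∞ (deriv f) := (contDiff_infty_iff_deriv.1 hf).2
    have hk := natCast_le_infty (k + 1)
    have hc1 : ContDiffAt ℝ ((k + 1 : ℕ) : WithTop ℕ∞) (fun y => c * f y) x :=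
      (contDiff_const.mul hf).contDiffAt.of_le hk
    have hc2 : ContDiffAt ℝ ((k + 1 : ℕ) : WithTop ℕ∞) (fun y => (c * y + d) * deriv f y) x :=
      (((contDiff_const.mul contDiff_id).add contDiff_const).mul hf').contDiffAt.of_le hk
    rw [iteratedDeriv_succ', h, iteratedDeriv_fun_add hc1 hc2, ih hf', iteratedDeriv_const_mul_field,
      ← iteratedDeriv_succ', ← iteratedDeriv_succ']
    push_cast
    ring

theorem contDiff_slice_right {f : ℝ → ℝ → ℝ} (hf : ContDiff ℝ ∞ fun p : ℝ × ℝ => f p.1 p.2)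
    (t : ℝ) : ContDiff ℝ ∞ (f t) := by
  have hy : ContDiff ℝ ∞ fun y : ℝ => (t, y) := contDiff_const.prodMk contDiff_id
  exact hf.comp hy

theorem contDiff_slice_left {f : ℝ → ℝ → ℝ} (hf : ContDiff ℝ ∞ fun p : ℝ × ℝ => f p.1 p.2)
    (x : ℝ) : ContDiff ℝ ∞ fun s => f s x := by
  have hy : ContDiff ℝ ∞ fun s : ℝ => (s, x) := contDiff_id.prodMk contDiff_const
  exact hf.comp hy

section Characteristic

variable {n : ℝ} {U I : Set ℝ} {τ : ℝ → ℝ} {c d t x : ℝ} {u : ℝ → ℝ → ℝ}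

theorem characteristic_symField (ht : t ∈ I) (hx : u t x ∈ U) :
    characteristic (symField n I U τ c d) u t x =
      (c - deriv τ t) / n * u t x - τ t * pderiv 1 0 u t x - (c * x + d) * pderiv 0 1 u t x := by
  rw [characteristic, symField_apply ht hx]

theorem pderiv_zero_characteristic_symField (hU : IsOpen U)
    (hu : ContDiff ℝ ∞ fun p : ℝ × ℝ => u p.1 p.2) (ht : t ∈ I) (hux : u t x ∈ U) (k : ℕ) :
    pderiv 0 (k + 1) (characteristic (symField n I U τ c d) u) t x =
      (c - deriv τ t) / n * pderiv 0 (k + 1) u t x - τ t * pderiv 1 (k + 1) u t x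
      - ((c * x + d) * pderiv 0 (k + 2) u t x + (k + 1) * c * pderiv 0 (k + 1) u t x) := by
  have hus : ContDiff ℝ ∞ (u t) := contDiff_slice_right hu t
  have hut : ContDiff ℝ ∞ (pderiv 1 0 u t) := contDiff_slice_right (contDiff_pderiv_one hu 0) t
  have hux' : ContDiff ℝ ∞ (pderiv 0 1 u t) := contDiff_slice_right (contDiff_pderiv_zero hu 1) t
  -- The extension by zero plays no role: `U` is open, so `u t y` stays in `U` for `y` near `x`.
  have hev : characteristic (symField n I U τ c d) u t =ᶠ[nhds x] fun y =>
      (c - deriv τ t) / n * u t y - τ t * pderiv 1 0 u t y - (c * y + d) * pderiv 0 1 u t y := by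
    filter_upwards [hus.continuous.continuousAt.eventually_mem (hU.mem_nhds hux)] with y hy
    exact characteristic_symField ht hy
  have hk := natCast_le_infty (k + 1)
  have c1 : ContDiffAt ℝ ((k + 1 : ℕ) : WithTop ℕ∞) (fun y => (c - deriv τ t) / n * u t y) x :=
    (contDiff_const.mul hus).contDiffAt.of_le hk
  have c2 : ContDiffAt ℝ ((k + 1 : ℕ) : WithTop ℕ∞) (fun y => τ t * pderiv 1 0 u t y) x :=
    (contDiff_const.mul hut).contDiffAt.of_le hk
  have c3 : ContDiffAt ℝ ((k + 1 : ℕ) : WithTop ℕ∞)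
      (fun y => (c * y + d) * pderiv 0 1 u t y) x := by
    have h : ContDiff ℝ ∞ fun y : ℝ => c * y + d := by fun_prop
    exact (h.mul hux').contDiffAt.of_le hk
  have e0 : iteratedDeriv (k + 1) (u t) x = pderiv 0 (k + 1) u t x := by
    rw [pderiv, iteratedDeriv_zero]
  have e1 : iteratedDeriv (k + 1) (pderiv 1 0 u t) x = pderiv 1 (k + 1) u t x :=
    iteratedDeriv_pderiv_one hu (k + 1) t x
  have e2 : iteratedDeriv (k + 1) (pderiv 0 1 u t) x = pderiv 0 (k + 2) u t x := by
    rw [iteratedDeriv_pderiv_zero, show 1 + (k + 1) = k + 2 by ring]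
  have e3 : iteratedDeriv k (pderiv 0 1 u t) x = pderiv 0 (k + 1) u t x := by
    rw [iteratedDeriv_pderiv_zero, add_comm 1 k]
  rw [pderiv, iteratedDeriv_zero, hev.iteratedDeriv_eq, iteratedDeriv_fun_sub (c1.sub c2) c3,
    iteratedDeriv_fun_sub c1 c2, iteratedDeriv_succ_affine_mul hux', e2, e3]
  simp only [iteratedDeriv_const_mul_field, e0, e1]

theorem pderiv_one_characteristic_symField (hU : IsOpen U) (hI : IsOpen I)
    (hτ : ContDiffOn ℝ ∞ τ I) (hu : ContDiff ℝ ∞ fun p : ℝ × ℝ => u p.1 p.2) (ht : t ∈ I)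
    (hux : u t x ∈ U) :
    pderiv 1 0 (characteristic (symField n I U τ c d) u) t x =
      (-deriv (deriv τ) t / n * u t x + (c - deriv τ t) / n * pderiv 1 0 u t x)
      - (deriv τ t * pderiv 1 0 u t x + τ t * pderiv 2 0 u t x)
      - (c * x + d) * pderiv 1 1 u t x := by
  have hτ1 : HasDerivAt τ (deriv τ t) t :=
    ((hτ.contDiffAt (hI.mem_nhds ht)).differentiableAt (by simp)).hasDerivAt
  have hτ2 : HasDerivAt (deriv τ) (deriv (deriv τ) t) t :=
    (((contDiffOn_deriv hI hτ).contDiffAt (hI.mem_nhds ht)).differentiableAt (by simp)).hasDerivAt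
  have hd0 : HasDerivAt (fun s => u s x) (pderiv 1 0 u t x) t := by
    have := ((contDiff_slice_left hu x).differentiable (by simp) t).hasDerivAt
    simpa [pderiv, iteratedDeriv_one, Function.comp_def] using this
  have hd1 : HasDerivAt (fun s => pderiv 1 0 u s x) (pderiv 2 0 u t x) t := by
    have := ((contDiff_slice_left (contDiff_pderiv_one hu 0) x).differentiable (by simp) t).hasDerivAt
    simpa [pderiv, iteratedDeriv_one, Function.comp_def, iteratedDeriv_succ] using this
  have hd2 : HasDerivAt (fun s => pderiv 0 1 u s x) (pderiv 1 1 u t x) t := by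
    have := ((contDiff_slice_left (contDiff_pderiv_zero hu 1) x).differentiable (by simp) t).hasDerivAt
    simpa [pderiv, iteratedDeriv_one, Function.comp_def] using this
  have hev : (fun s => characteristic (symField n I U τ c d) u s x) =ᶠ[nhds t] fun s =>
      (c - deriv τ s) / n * u s x - τ s * pderiv 1 0 u s x - (c * x + d) * pderiv 0 1 u s x := by
    filter_upwards [hd0.continuousAt.eventually_mem (hU.mem_nhds hux), hI.mem_nhds ht] with s hy hs
    exact characteristic_symField hs hy
  have hD := ((((hτ2.const_sub c).div_const n).mul hd0).sub (hτ1.mul hd1)).sub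
    (hd2.const_mul (c * x + d))
  have e : pderiv 1 0 (characteristic (symField n I U τ c d) u) t x =
      deriv (fun s => characteristic (symField n I U τ c d) u s x) t := by
    rw [pderiv, iteratedDeriv_one]
    simp only [iteratedDeriv_zero]
  rw [e, hev.deriv_eq]
  exact hD.deriv

end Characteristic

/-- The prolonged field multiplies the left-hand side by `(c - τ_t)/n - τ_t`, once the determining
equations are used; the derivatives `u_tt`, `u_tx`, `u_xx`, `u_txxxxx` and `u_xxxxxx` cancel against
the correction terms of the prolongation. -/
theorem symField_mem_Amax {n : ℝ} {U : Set ℝ} (h : Admissible n U) {E : Equation} {τ : ℝ → ℝ}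
    {c : ℝ} (hs : IsSym n E τ c) (d : ℝ) : symField n E.I U τ c d ∈ Amax n U E := by
  refine ⟨contDiffOn_symField E.isOpen_I hs.smooth, fun p hp => symField_of_notMem hp, ?_⟩
  intro u hu t x ht hux h0
  have h1 := pderiv_zero_characteristic_symField (n := n) (τ := τ) (c := c) (d := d)
    h.isOpen hu ht hux 0
  have h5 := pderiv_zero_characteristic_symField (n := n) (τ := τ) (c := c) (d := d)
    h.isOpen hu ht hux 4
  simp only [zero_add, Nat.reduceAdd] at h1 h5
  rw [fderiv_lhs_prolong5 h E _ u ht hux, symField_apply ht hux, h1, h5,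
    pderiv_one_characteristic_symField h.isOpen E.isOpen_I hs.smooth hu ht hux]
  rw [lhs_jet5] at h0
  have hβ := hs.eq_β t ht
  have hα := hs.eq_α t ht
  have hm := h.mul_self _ hux
  have hn := h.ne_zero
  have ha : n * ((c - deriv τ t) / n) = c - deriv τ t := by field_simp
  have ha' : -deriv (deriv τ) t / n = -(deriv τ t * E.α t + τ t * deriv E.α t) := by
    rw [hα]; ring
  rw [ha']
  generalize (c - deriv τ t) / n = a at *
  push_cast
  linear_combination (a - deriv τ t) * h0 + pderiv 0 5 u t x * hβ
    + n * a * pderiv 0 1 u t x * hm + u t x ^ n * pderiv 0 1 u t x * ha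

/-! ### Slices of functions of `(t, x, u)` -/

/-- The restriction of a function of `(t, x, u)` to a fixed value of `t`. -/
def xuSlice (f : ℝ × ℝ × ℝ → ℝ) (t : ℝ) : ℝ × ℝ → ℝ := fun z => f (t, z.1, z.2)

/-- The restriction of a function of `(t, x, u)` to a fixed value of `x`. -/
def tuSlice (f : ℝ × ℝ × ℝ → ℝ) (x : ℝ) : ℝ × ℝ → ℝ := fun z => f (z.1, x, z.2)

section Slices

variable {I U : Set ℝ} {f : ℝ × ℝ × ℝ → ℝ} {t x A : ℝ}

theorem contDiffOn_xuSlice (hf : ContDiffOn ℝ ∞ f (dom I U)) (ht : t ∈ I) :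
    ContDiffOn ℝ ∞ (xuSlice f t) (univ ×ˢ U) :=
  hf.comp (g := f) (f := fun z : ℝ × ℝ => (t, z.1, z.2)) (ContDiff.contDiffOn (by fun_prop))
    fun _ hz => mem_dom.2 ⟨ht, hz.2⟩

theorem contDiffOn_tuSlice (hf : ContDiffOn ℝ ∞ f (dom I U)) (x : ℝ) :
    ContDiffOn ℝ ∞ (tuSlice f x) (I ×ˢ U) :=
  hf.comp (g := f) (f := fun z : ℝ × ℝ => (z.1, x, z.2)) (ContDiff.contDiffOn (by fun_prop))
    fun _ hz => mem_dom.2 ⟨hz.1, hz.2⟩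

theorem dirDeriv_tuSlice_eq (hI : IsOpen I) (hU : IsOpen U) (hf : ContDiffOn ℝ ∞ f (dom I U))
    (ht : t ∈ I) (hA : A ∈ U) :
    dirDeriv (0, 1) (tuSlice f x) (t, A) = dirDeriv (0, 1) (xuSlice f t) (x, A) := by
  have h1 := hasDerivAt_comp_curve (hI.prod hU) (contDiffOn_tuSlice hf x) (hasDerivAt_const A t)
    (hasDerivAt_id A) (show (t, id A) ∈ I ×ˢ U from ⟨ht, hA⟩)
  have h2 := hasDerivAt_comp_curve (isOpen_univ.prod hU) (contDiffOn_xuSlice hf ht)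
    (hasDerivAt_const A x) (hasDerivAt_id A)
    (show (x, id A) ∈ (univ : Set ℝ) ×ˢ U from ⟨mem_univ _, hA⟩)
  exact h1.unique h2

theorem hasDerivAt_tuSlice (hI : IsOpen I) (hU : IsOpen U) (hf : ContDiffOn ℝ ∞ f (dom I U))
    (ht : t ∈ I) (hA : A ∈ U) (x q : ℝ) :
    HasDerivAt (fun s => f (s, x, A + (s - t) * q))
      (dirDeriv (1, 0) (tuSlice f x) (t, A) + dirDeriv (0, 1) (xuSlice f t) (x, A) * q) t := by
  have hb : HasDerivAt (fun s => A + (s - t) * q) q t := by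
    simpa using (((hasDerivAt_id t).sub_const t).mul_const q).const_add A
  have h := hasDerivAt_comp_curve (hI.prod hU) (contDiffOn_tuSlice hf x) (hasDerivAt_id t) hb
    (by simpa using ⟨ht, hA⟩)
  rw [← dirDeriv_tuSlice_eq hI hU hf ht hA, ← dirDeriv_add_smul]
  simpa [tuSlice] using h

end Slices

/-! ### Test functions -/

theorem iteratedDeriv_sub_pow_self (j k : ℕ) (x₀ : ℝ) :
    iteratedDeriv k (fun y : ℝ => (y - x₀) ^ j) x₀ = if k = j then (j.factorial : ℝ) else 0 := by
  rw [iteratedDeriv_comp_sub_const k (fun y : ℝ => y ^ j) x₀]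
  simp only [sub_self]
  rw [iteratedDeriv_fun_pow_zero]
  split_ifs <;> simp

/-- The polynomial with the derivatives `a` and `b` of orders four and five at `x₀`. -/
def quintic (x₀ a b : ℝ) (y : ℝ) : ℝ := a / 24 * (y - x₀) ^ 4 + b / 120 * (y - x₀) ^ 5

theorem contDiff_quintic (x₀ a b : ℝ) : ContDiff ℝ ∞ (quintic x₀ a b) := by
  unfold quintic
  fun_prop

theorem iteratedDeriv_quintic (x₀ a b : ℝ) (k : ℕ) :
    iteratedDeriv k (quintic x₀ a b) x₀ = if k = 4 then a else if k = 5 then b else 0 := by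
  have hk := natCast_le_infty k
  have h1 : ContDiffAt ℝ k (fun y : ℝ => a / 24 * (y - x₀) ^ 4) x₀ :=
    (ContDiff.contDiffAt (by fun_prop))
  have h2 : ContDiffAt ℝ k (fun y : ℝ => b / 120 * (y - x₀) ^ 5) x₀ :=
    (ContDiff.contDiffAt (by fun_prop))
  unfold quintic
  rw [iteratedDeriv_fun_add h1 h2]
  simp only [iteratedDeriv_const_mul_field, iteratedDeriv_sub_pow_self]
  rcases eq_or_ne k 4 with rfl | h4
  · simp [Nat.factorial]
  · rcases eq_or_ne k 5 with rfl | h5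
    · simp [Nat.factorial]
    · simp [h4, h5]


theorem pderiv_zero_affine {p q : ℝ → ℝ} (hp : ContDiff ℝ ∞ p) (hq : ContDiff ℝ ∞ q)
    (t₀ : ℝ) (k : ℕ) (t x : ℝ) :
    pderiv 0 k (fun s y => p y + (s - t₀) * q y) t x =
      iteratedDeriv k p x + (t - t₀) * iteratedDeriv k q x := by
  have hk := natCast_le_infty k
  rw [pderiv, iteratedDeriv_zero, iteratedDeriv_fun_add (hp.contDiffAt.of_le hk)
    ((contDiff_const.mul hq).contDiffAt.of_le hk), iteratedDeriv_const_mul_field]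

theorem pderiv_one_affine {p q : ℝ → ℝ} (hp : ContDiff ℝ ∞ p) (hq : ContDiff ℝ ∞ q)
    (t₀ : ℝ) (k : ℕ) (t x : ℝ) :
    pderiv 1 k (fun s y => p y + (s - t₀) * q y) t x = iteratedDeriv k q x := by
  have h : pderiv 1 k (fun s y => p y + (s - t₀) * q y) t x =
      deriv (fun s => pderiv 0 k (fun s y => p y + (s - t₀) * q y) s x) t := by
    simp [pderiv, iteratedDeriv_one]
  simp only [h, pderiv_zero_affine hp hq]
  simp

theorem pderiv_two_affine {p q : ℝ → ℝ} (hp : ContDiff ℝ ∞ p) (hq : ContDiff ℝ ∞ q)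
    (t₀ t x : ℝ) : pderiv 2 0 (fun s y => p y + (s - t₀) * q y) t x = 0 := by
  have h : pderiv 2 0 (fun s y => p y + (s - t₀) * q y) t x =
      deriv (fun s => pderiv 1 0 (fun s y => p y + (s - t₀) * q y) s x) t := by
    simp [pderiv, iteratedDeriv_succ]
  simp only [h, pderiv_one_affine hp hq, deriv_const]

theorem contDiff_affine {p q : ℝ → ℝ} (hp : ContDiff ℝ ∞ p) (hq : ContDiff ℝ ∞ q) (t₀ : ℝ) :
    ContDiff ℝ ∞ fun z : ℝ × ℝ => p z.2 + (z.1 - t₀) * q z.2 := by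
  fun_prop

/-! ### The determining identity -/

theorem hasDerivAt_comp_flat {S : Set (ℝ × ℝ)} (hS : IsOpen S) {H : ℝ × ℝ → ℝ}
    (hH : ContDiffOn ℝ ∞ H S) {x₀ A : ℝ} (hA : (x₀, A) ∈ S) {r : ℝ → ℝ} (hr : ContDiff ℝ ∞ r)
    (hr0 : ∀ j ≤ 3, iteratedDeriv j r x₀ = 0) (m : ℝ) :
    HasDerivAt (fun y => H (y, A + m * (y - x₀) + r y)) (dirDeriv (1, m) H (x₀, A)) x₀ := by
  have hz : r x₀ = 0 := by simpa using hr0 0 (by norm_num)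
  have h := iteratedDeriv_comp_perturbed_of_flat (m := m) hS hH hA hr 1
    fun j hj => hr0 j (by omega)
  have hd := ((contDiffAt_comp_perturbed (m := m) hS hH hA hr hz).differentiableAt
    (by simp)).hasDerivAt
  rw [iteratedDeriv_one, Function.iterate_one] at h
  rwa [h] at hd

section TestCharacteristic

variable {S : Set (ℝ × ℝ)} {Hη Hτ Hξ : ℝ × ℝ → ℝ} {x₀ A : ℝ} {r w : ℝ → ℝ}

theorem deriv_test_characteristic (hS : IsOpen S) (xη : ContDiffOn ℝ ∞ Hη S)
    (xτ : ContDiffOn ℝ ∞ Hτ S) (xξ : ContDiffOn ℝ ∞ Hξ S) (hA : (x₀, A) ∈ S)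
    (hr : ContDiff ℝ ∞ r) (hr0 : ∀ j ≤ 3, iteratedDeriv j r x₀ = 0)
    (hw : ContDiff ℝ ∞ w) (hw0 : ∀ j ≤ 3, iteratedDeriv j w x₀ = 0) (m q : ℝ) :
    deriv (fun y => Hη (y, A + m * (y - x₀) + r y) - Hτ (y, A + m * (y - x₀) + r y) * (q + w y)
      - Hξ (y, A + m * (y - x₀) + r y) * (m + deriv r y)) x₀ =
      dirDeriv (1, m) Hη (x₀, A) - dirDeriv (1, m) Hτ (x₀, A) * q
        - dirDeriv (1, m) Hξ (x₀, A) * m := by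
  have wz : w x₀ = 0 := by simpa using hw0 0 (by norm_num)
  have rz : deriv r x₀ = 0 := by simpa using hr0 1 (by norm_num)
  have w1 : HasDerivAt (fun y => q + w y) 0 x₀ := by
    have e : deriv w x₀ = 0 := by simpa using hw0 1 (by norm_num)
    have := (hw.differentiable (by simp) x₀).hasDerivAt
    rw [e] at this
    exact this.const_add q
  have r1 : HasDerivAt (fun y => m + deriv r y) 0 x₀ := by
    have e : deriv (deriv r) x₀ = 0 := by
      simpa [iteratedDeriv_succ] using hr0 2 (by norm_num)
    have := ((contDiff_infty_iff_deriv.1 hr).2.differentiable (by simp) x₀).hasDerivAt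
    rw [e] at this
    exact this.const_add m
  have h := ((hasDerivAt_comp_flat hS xη hA hr hr0 m).sub
    ((hasDerivAt_comp_flat hS xτ hA hr hr0 m).mul w1)).sub
    ((hasDerivAt_comp_flat hS xξ hA hr hr0 m).mul r1)
  simp only [wz, rz, mul_zero, add_zero] at h
  exact h.deriv

/-- Here `q + w` stands for `u_t` and `m + r'` for `u_x`. The former deviates from its value only at
order four, the latter already at order three, so a second derivative of a coefficient appears for
`ξ` but not for `τ`. -/
theorem iteratedDeriv_five_test_characteristic (hS : IsOpen S) (xη : ContDiffOn ℝ ∞ Hη S)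
    (xτ : ContDiffOn ℝ ∞ Hτ S) (xξ : ContDiffOn ℝ ∞ Hξ S) (hA : (x₀, A) ∈ S)
    (hr : ContDiff ℝ ∞ r) (hr0 : ∀ j ≤ 3, iteratedDeriv j r x₀ = 0)
    (hw : ContDiff ℝ ∞ w) (hw0 : ∀ j ≤ 3, iteratedDeriv j w x₀ = 0) (m q : ℝ) :
    iteratedDeriv 5 (fun y => Hη (y, A + m * (y - x₀) + r y)
      - Hτ (y, A + m * (y - x₀) + r y) * (q + w y)
      - Hξ (y, A + m * (y - x₀) + r y) * (m + deriv r y)) x₀ =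
      ((dirDeriv (1, m))^[5] Hη (x₀, A)
        + 5 * dirDeriv (1, m) (dirDeriv (0, 1) Hη) (x₀, A) * iteratedDeriv 4 r x₀
        + dirDeriv (0, 1) Hη (x₀, A) * iteratedDeriv 5 r x₀)
      - (q * ((dirDeriv (1, m))^[5] Hτ (x₀, A)
        + 5 * dirDeriv (1, m) (dirDeriv (0, 1) Hτ) (x₀, A) * iteratedDeriv 4 r x₀
        + dirDeriv (0, 1) Hτ (x₀, A) * iteratedDeriv 5 r x₀)
        + 5 * dirDeriv (1, m) Hτ (x₀, A) * iteratedDeriv 4 w x₀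
        + Hτ (x₀, A) * iteratedDeriv 5 w x₀)
      - (m * ((dirDeriv (1, m))^[5] Hξ (x₀, A)
        + 5 * dirDeriv (1, m) (dirDeriv (0, 1) Hξ) (x₀, A) * iteratedDeriv 4 r x₀
        + dirDeriv (0, 1) Hξ (x₀, A) * iteratedDeriv 5 r x₀)
        + 10 * (dirDeriv (1, m))^[2] Hξ (x₀, A) * iteratedDeriv 4 r x₀
        + 5 * dirDeriv (1, m) Hξ (x₀, A) * iteratedDeriv 5 r x₀
        + Hξ (x₀, A) * iteratedDeriv 6 r x₀) := by
  have rz : r x₀ = 0 := by simpa using hr0 0 (by norm_num)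
  have hr' : ContDiff ℝ ∞ (deriv r) := (contDiff_infty_iff_deriv.1 hr).2
  have hr0' : ∀ j ≤ 2, iteratedDeriv j (deriv r) x₀ = 0 := fun j hj => by
    rw [← iteratedDeriv_succ']
    exact hr0 _ (by omega)
  have h5 := natCast_le_infty 5
  have cη := (contDiffAt_comp_perturbed (m := m) hS xη hA hr rz).of_le h5
  have cτ := ((contDiffAt_comp_perturbed (m := m) hS xτ hA hr rz).mul
    (contDiff_const.add hw : ContDiff ℝ ∞ fun y => q + w y).contDiffAt).of_le h5
  have cξ := ((contDiffAt_comp_perturbed (m := m) hS xξ hA hr rz).mul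
    (contDiff_const.add hr' : ContDiff ℝ ∞ fun y => m + deriv r y).contDiffAt).of_le h5
  rw [iteratedDeriv_fun_sub (cη.sub cτ) cξ, iteratedDeriv_fun_sub cη cτ,
    iteratedDeriv_five_comp_perturbed_mul hS xτ hA hr hr0 hw (fun j hj => hw0 j (by omega)),
    iteratedDeriv_five_comp_perturbed_mul hS xξ hA hr hr0 hr' hr0',
    iteratedDeriv_five_comp_perturbed hS xη hA hr hr0,
    iteratedDeriv_five_comp_perturbed hS xτ hA hr hr0,
    iteratedDeriv_five_comp_perturbed hS xξ hA hr hr0, hw0 3 le_rfl,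
    ← iteratedDeriv_succ', ← iteratedDeriv_succ', ← iteratedDeriv_succ']
  ring

end TestCharacteristic

/-- The invariance condition on the jets of the functions
`A + m (x - x₀) + a (x - x₀)⁴ / 24 + b (x - x₀)⁵ / 120 + (t - t₀) (q + e (x - x₀)⁴ / 24)`. -/
theorem determining_identity {n : ℝ} {U : Set ℝ} (h : Admissible n U) {E : Equation} {Q : VField}
    (hQ : Q ∈ Amax n U E) {t₀ x₀ A : ℝ} (ht : t₀ ∈ E.I) (hA : A ∈ U) {τ ξ η : ℝ × ℝ × ℝ → ℝ}
    (hτ : τ = fun p => (Q p).1) (hξ : ξ = fun p => (Q p).2.1) (hη : η = fun p => (Q p).2.2)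
    (m a b e q : ℝ) (hq : q + A ^ n * m + E.α t₀ * A + E.β t₀ * b = 0) :
    deriv E.α t₀ * τ (t₀, x₀, A) * A + deriv E.β t₀ * τ (t₀, x₀, A) * b
      + (n * A ^ (n - 1) * m + E.α t₀) * η (t₀, x₀, A)
      + A ^ n * (dirDeriv (1, m) (xuSlice η t₀) (x₀, A)
        - dirDeriv (1, m) (xuSlice τ t₀) (x₀, A) * q
        - dirDeriv (1, m) (xuSlice ξ t₀) (x₀, A) * m)
      + ((dirDeriv (1, 0) (tuSlice η x₀) (t₀, A) + dirDeriv (0, 1) (xuSlice η t₀) (x₀, A) * q)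
        - (dirDeriv (1, 0) (tuSlice τ x₀) (t₀, A) + dirDeriv (0, 1) (xuSlice τ t₀) (x₀, A) * q) * q
        - (dirDeriv (1, 0) (tuSlice ξ x₀) (t₀, A) + dirDeriv (0, 1) (xuSlice ξ t₀) (x₀, A) * q) * m)
      + E.β t₀ * (((dirDeriv (1, m))^[5] (xuSlice η t₀) (x₀, A)
          + 5 * dirDeriv (1, m) (dirDeriv (0, 1) (xuSlice η t₀)) (x₀, A) * a
          + dirDeriv (0, 1) (xuSlice η t₀) (x₀, A) * b)
        - (q * ((dirDeriv (1, m))^[5] (xuSlice τ t₀) (x₀, A)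
          + 5 * dirDeriv (1, m) (dirDeriv (0, 1) (xuSlice τ t₀)) (x₀, A) * a
          + dirDeriv (0, 1) (xuSlice τ t₀) (x₀, A) * b)
          + 5 * dirDeriv (1, m) (xuSlice τ t₀) (x₀, A) * e)
        - (m * ((dirDeriv (1, m))^[5] (xuSlice ξ t₀) (x₀, A)
          + 5 * dirDeriv (1, m) (dirDeriv (0, 1) (xuSlice ξ t₀)) (x₀, A) * a
          + dirDeriv (0, 1) (xuSlice ξ t₀) (x₀, A) * b)
          + 10 * (dirDeriv (1, m))^[2] (xuSlice ξ t₀) (x₀, A) * a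
          + 5 * dirDeriv (1, m) (xuSlice ξ t₀) (x₀, A) * b)) = 0 := by
  have hS : IsOpen ((univ : Set ℝ) ×ˢ U) := isOpen_univ.prod h.isOpen
  have hAS : (x₀, A) ∈ (univ : Set ℝ) ×ˢ U := ⟨mem_univ _, hA⟩
  have sτ : ContDiffOn ℝ ∞ τ (dom E.I U) := by rw [hτ]; exact hQ.1.fst
  have sξ : ContDiffOn ℝ ∞ ξ (dom E.I U) := by rw [hξ]; exact hQ.1.snd.fst
  have sη : ContDiffOn ℝ ∞ η (dom E.I U) := by rw [hη]; exact hQ.1.snd.snd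
  have hr := contDiff_quintic x₀ a b
  have hw := contDiff_quintic x₀ e 0
  have ir := iteratedDeriv_quintic x₀ a b
  have iw := iteratedDeriv_quintic x₀ e 0
  generalize quintic x₀ a b = r at hr ir
  generalize quintic x₀ e 0 = w at hw iw
  have r0 : ∀ j ≤ 3, iteratedDeriv j r x₀ = 0 := fun j hj => by
    rw [ir, if_neg (by omega), if_neg (by omega)]
  have w0 : ∀ j ≤ 3, iteratedDeriv j w x₀ = 0 := fun j hj => by
    rw [iw, if_neg (by omega), if_neg (by omega)]
  have rz : r x₀ = 0 := by simpa using r0 0 (by norm_num)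
  have wz : w x₀ = 0 := by simpa using w0 0 (by norm_num)
  have rz' : deriv r x₀ = 0 := by simpa using r0 1 (by norm_num)
  have wz' : deriv w x₀ = 0 := by simpa using w0 1 (by norm_num)
  have hd := deriv_test_characteristic hS (contDiffOn_xuSlice sη ht) (contDiffOn_xuSlice sτ ht)
    (contDiffOn_xuSlice sξ ht) hAS hr r0 hw w0 m q
  have hd5 := iteratedDeriv_five_test_characteristic hS (contDiffOn_xuSlice sη ht)
    (contDiffOn_xuSlice sτ ht) (contDiffOn_xuSlice sξ ht) hAS hr r0 hw w0 m q
  have cp : ContDiff ℝ ∞ fun y => A + m * (y - x₀) + r y := by fun_prop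
  have cg : ContDiff ℝ ∞ fun y => q + w y := by fun_prop
  have dp : deriv (fun y => A + m * (y - x₀) + r y) = fun y => m + deriv r y := by
    funext y
    have hb := ((((hasDerivAt_id y).sub_const x₀).const_mul m).const_add A).add
      (hr.differentiable (by simp) y).hasDerivAt
    rw [mul_one] at hb
    exact hb.deriv
  have ip : ∀ k, iteratedDeriv (k + 2) (fun y => A + m * (y - x₀) + r y) x₀ =
      iteratedDeriv (k + 2) r x₀ := by
    intro k
    rw [iteratedDeriv_succ', dp, iteratedDeriv_const_add k.succ_pos, ← iteratedDeriv_succ']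
  have ig : ∀ k, iteratedDeriv (k + 1) (fun y => q + w y) x₀ = iteratedDeriv (k + 1) w x₀ :=
    fun k => iteratedDeriv_const_add k.succ_pos q
  -- At `(t₀, x₀)` the derivatives `u_xx`, `u_xxxxxx`, `u_tx`, `u_txxxxx` and `u_tt` vanish. Hence
  -- the corrections `τ u_{J,t} + ξ u_{J,x}` drop out for `J = t`, `x` and `xxxxx`.
  set u : ℝ → ℝ → ℝ := fun s y => (A + m * (y - x₀) + r y) + (s - t₀) * (q + w y) with hu
  have u0 : ∀ y, u t₀ y = A + m * (y - x₀) + r y := fun y => by simp [hu]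
  have ux : u t₀ x₀ = A := by simp [hu, rz]
  have uxs : ∀ s, u s x₀ = A + (s - t₀) * q := fun s => by simp [hu, rz, wz]
  have d0 := pderiv_zero_affine cp cg t₀
  have d1 := pderiv_one_affine cp cg t₀
  have d2 := pderiv_two_affine cp cg t₀ t₀ x₀
  rw [← hu] at d0 d1 d2
  have e01 : ∀ s y, pderiv 0 1 u s y = m + deriv r y + (s - t₀) * deriv w y := by
    intro s y
    rw [d0, iteratedDeriv_one, iteratedDeriv_one, dp, deriv_const_add]
  have e10 : ∀ s y, pderiv 1 0 u s y = q + w y := fun s y => by rw [d1, iteratedDeriv_zero]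
  have e05 : pderiv 0 5 u t₀ x₀ = b := by rw [d0, ip 3, ir]; simp
  have e02 : pderiv 0 2 u t₀ x₀ = 0 := by rw [d0, ip 0, ir]; simp
  have e06 : pderiv 0 6 u t₀ x₀ = 0 := by rw [d0, ip 4, ir]; simp
  have e11 : pderiv 1 1 u t₀ x₀ = 0 := by rw [d1, ig 0, iw]; simp
  have e15 : pderiv 1 5 u t₀ x₀ = 0 := by rw [d1, ig 4, iw]; simp
  have hχ : characteristic Q u t₀ = fun y => xuSlice η t₀ (y, A + m * (y - x₀) + r y)
      - xuSlice τ t₀ (y, A + m * (y - x₀) + r y) * (q + w y)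
      - xuSlice ξ t₀ (y, A + m * (y - x₀) + r y) * (m + deriv r y) := by
    funext y
    simp only [characteristic, e01, e10, u0, xuSlice, hτ, hξ, hη, sub_self, zero_mul, add_zero]
  have f05 : pderiv 0 5 (characteristic Q u) t₀ x₀ = iteratedDeriv 5 (characteristic Q u t₀) x₀ := by
    rw [pderiv, iteratedDeriv_zero]
  rw [hχ, hd5] at f05
  have f01 : pderiv 0 1 (characteristic Q u) t₀ x₀ = deriv (characteristic Q u t₀) x₀ := by
    rw [pderiv, iteratedDeriv_zero, iteratedDeriv_one]
  rw [hχ, hd] at f01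
  have f10 : pderiv 1 0 (characteristic Q u) t₀ x₀ =
      (dirDeriv (1, 0) (tuSlice η x₀) (t₀, A) + dirDeriv (0, 1) (xuSlice η t₀) (x₀, A) * q)
        - (dirDeriv (1, 0) (tuSlice τ x₀) (t₀, A) + dirDeriv (0, 1) (xuSlice τ t₀) (x₀, A) * q) * q
        - (dirDeriv (1, 0) (tuSlice ξ x₀) (t₀, A)
          + dirDeriv (0, 1) (xuSlice ξ t₀) (x₀, A) * q) * m := by
    have hc : pderiv 1 0 (characteristic Q u) t₀ x₀ =
        deriv (fun s => η (s, x₀, A + (s - t₀) * q) - τ (s, x₀, A + (s - t₀) * q) * q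
          - ξ (s, x₀, A + (s - t₀) * q) * m) t₀ := by
      rw [pderiv, iteratedDeriv_one]
      congr 1
      funext s
      simp only [iteratedDeriv_zero, characteristic, e01, e10, uxs, hτ, hξ, hη, wz, rz', wz',
        mul_zero, add_zero]
    rw [hc]
    exact (((hasDerivAt_tuSlice E.isOpen_I h.isOpen sη ht hA x₀ q).sub
      ((hasDerivAt_tuSlice E.isOpen_I h.isOpen sτ ht hA x₀ q).mul_const q)).sub
      ((hasDerivAt_tuSlice E.isOpen_I h.isOpen sξ ht hA x₀ q).mul_const m)).deriv
  have hzero : E.lhs n (jet5 u t₀ x₀) = 0 := by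
    rw [lhs_jet5, e05, e01, e10, ux, wz, rz', wz']
    linear_combination hq
  have huA : u t₀ x₀ ∈ U := by rwa [ux]
  have key := hQ.2.2 u (contDiff_affine cp cg t₀) t₀ x₀ ht huA hzero
  rw [fderiv_lhs_prolong5 h E Q u ht huA, f05, f01, f10, e05, e06, e15, e11, e02, d2, e01, ux, ir,
    ir, ir, iw, iw, rz', wz'] at key
  subst hτ hξ hη
  norm_num at key ⊢
  linear_combination key

/-! ### Solution of the determining equations -/

theorem dirDeriv_eq_zero_of_const {S : Set (ℝ × ℝ)} (hS : IsOpen S) {K : ℝ × ℝ → ℝ} {k : ℝ}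
    (hK : ∀ q ∈ S, K q = k) (v : ℝ × ℝ) {q : ℝ × ℝ} (hq : q ∈ S) : dirDeriv v K q = 0 := by
  have h : K =ᶠ[nhds q] fun _ => k := by
    filter_upwards [hS.mem_nhds hq] with z hz
    exact hK z hz
  simp [dirDeriv, h.fderiv_eq]

theorem iterate_dirDeriv_eq_zero_of_const {S : Set (ℝ × ℝ)} (hS : IsOpen S) {K : ℝ × ℝ → ℝ} {k : ℝ}
    (hK : ∀ q ∈ S, K q = k) (v : ℝ × ℝ) (j : ℕ) {q : ℝ × ℝ} (hq : q ∈ S) :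
    (dirDeriv v)^[j + 1] K q = 0 := by
  induction j generalizing K k with
  | zero => exact dirDeriv_eq_zero_of_const hS hK v hq
  | succ j ih =>
    rw [Function.iterate_succ_apply]
    exact ih fun q hq => dirDeriv_eq_zero_of_const hS hK v hq

theorem dirDeriv_zero_one_eq_zero {H : ℝ × ℝ → ℝ} {q : ℝ × ℝ} {κ : ℝ}
    (h : ∀ m, dirDeriv (1, m) H q = κ) : dirDeriv (0, 1) H q = 0 := by
  have e := dirDeriv_add_smul H q 1 0 1
  rw [h, h] at e
  linarith

theorem dirDeriv_tuSlice_of_eventuallyEq {I U : Set ℝ} {f : ℝ × ℝ × ℝ → ℝ} {t x A : ℝ}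
    (hI : IsOpen I) (hU : IsOpen U) (hf : ContDiffOn ℝ ∞ f (dom I U)) (ht : t ∈ I) (hA : A ∈ U)
    {g : ℝ → ℝ} (hg : ∀ s ∈ I, f (s, x, A) = g s) :
    dirDeriv (1, 0) (tuSlice f x) (t, A) = deriv g t := by
  have h := hasDerivAt_tuSlice hI hU hf ht hA x 0
  simp only [mul_zero, add_zero] at h
  have he : (fun s => f (s, x, A)) =ᶠ[nhds t] g := by
    filter_upwards [hI.mem_nhds ht] with s hs
    exact hg s hs
  rw [← he.deriv_eq, h.deriv]

section Solve

variable {n : ℝ} {U : Set ℝ} {E : Equation} {Q : VField} {τ ξ η : ℝ × ℝ × ℝ → ℝ} {t₀ : ℝ}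

/-- The parameter `e = u_txxxx` is unconstrained by the equation and enters only through `-5 β e D_x
τ`; compare `e = 0` with `e = 1`. -/
theorem dirDeriv_τ_eq_zero (h : Admissible n U) (hQ : Q ∈ Amax n U E)
    (hτ : τ = fun p => (Q p).1) (ht : t₀ ∈ E.I) :
    ∀ z ∈ (univ : Set ℝ) ×ˢ U, ∀ m, dirDeriv (1, m) (xuSlice τ t₀) z = 0 := by
  rintro ⟨x₀, A⟩ ⟨-, hA⟩ m
  have h0 := determining_identity h hQ (x₀ := x₀) ht hA hτ rfl rfl m 0 0 0
    (-(A ^ n * m + E.α t₀ * A)) (by ring)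
  have h1 := determining_identity h hQ (x₀ := x₀) ht hA hτ rfl rfl m 0 0 1
    (-(A ^ n * m + E.α t₀ * A)) (by ring)
  have e : E.β t₀ * dirDeriv (1, m) (xuSlice τ t₀) (x₀, A) = 0 := by
    linear_combination (h0 - h1) / 5
  exact (mul_eq_zero.1 e).resolve_left (E.β_ne_zero t₀ ht)

theorem τ_eq (h : Admissible n U) (hQ : Q ∈ Amax n U E) (hτ : τ = fun p => (Q p).1)
    (ht : t₀ ∈ E.I) (x : ℝ) {A : ℝ} (hA : A ∈ U) : τ (t₀, x, A) = τ (t₀, 0, 1) := by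
  have sτ : ContDiffOn ℝ ∞ τ (dom E.I U) := by rw [hτ]; exact hQ.1.fst
  simpa [xuSlice] using eq_add_of_dirDeriv_eq h.isOpen h.convex (contDiffOn_xuSlice sτ ht)
    (dirDeriv_τ_eq_zero h hQ hτ ht) (x := 0) (y := x) (h.pos_mem 1 one_pos) hA

/-- The determining identity once `τ` is known to depend on `t` alone. -/
theorem determining_identity_τ (h : Admissible n U) (hQ : Q ∈ Amax n U E) {x₀ A : ℝ}
    (ht : t₀ ∈ E.I) (hA : A ∈ U) (hτ : τ = fun p => (Q p).1) (hξ : ξ = fun p => (Q p).2.1)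
    (hη : η = fun p => (Q p).2.2)
    (m a b q : ℝ) (hq : q + A ^ n * m + E.α t₀ * A + E.β t₀ * b = 0) :
    deriv E.α t₀ * τ (t₀, 0, 1) * A + deriv E.β t₀ * τ (t₀, 0, 1) * b
      + (n * A ^ (n - 1) * m + E.α t₀) * η (t₀, x₀, A)
      + A ^ n * (dirDeriv (1, m) (xuSlice η t₀) (x₀, A)
        - dirDeriv (1, m) (xuSlice ξ t₀) (x₀, A) * m)
      + ((dirDeriv (1, 0) (tuSlice η x₀) (t₀, A) + dirDeriv (0, 1) (xuSlice η t₀) (x₀, A) * q)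
        - deriv (fun s => τ (s, 0, 1)) t₀ * q
        - (dirDeriv (1, 0) (tuSlice ξ x₀) (t₀, A) + dirDeriv (0, 1) (xuSlice ξ t₀) (x₀, A) * q) * m)
      + E.β t₀ * (((dirDeriv (1, m))^[5] (xuSlice η t₀) (x₀, A)
          + 5 * dirDeriv (1, m) (dirDeriv (0, 1) (xuSlice η t₀)) (x₀, A) * a
          + dirDeriv (0, 1) (xuSlice η t₀) (x₀, A) * b)
        - (m * ((dirDeriv (1, m))^[5] (xuSlice ξ t₀) (x₀, A)
          + 5 * dirDeriv (1, m) (dirDeriv (0, 1) (xuSlice ξ t₀)) (x₀, A) * a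
          + dirDeriv (0, 1) (xuSlice ξ t₀) (x₀, A) * b)
          + 10 * (dirDeriv (1, m))^[2] (xuSlice ξ t₀) (x₀, A) * a
          + 5 * dirDeriv (1, m) (xuSlice ξ t₀) (x₀, A) * b)) = 0 := by
  have sτ : ContDiffOn ℝ ∞ τ (dom E.I U) := by rw [hτ]; exact hQ.1.fst
  have hS : IsOpen ((univ : Set ℝ) ×ˢ U) := isOpen_univ.prod h.isOpen
  have hz : (x₀, A) ∈ (univ : Set ℝ) ×ˢ U := ⟨mem_univ _, hA⟩
  have hD := dirDeriv_τ_eq_zero h hQ hτ ht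
  have hc : ∀ z ∈ (univ : Set ℝ) ×ˢ U, xuSlice τ t₀ z = τ (t₀, 0, 1) := fun z hz =>
    τ_eq h hQ hτ ht z.1 hz.2
  have key := determining_identity h hQ (x₀ := x₀) ht hA hτ hξ hη m a b 0 q hq
  rw [hD _ hz, dirDeriv_zero_one_eq_zero (hD _ hz), iterate_dirDeriv_eq_zero_of_const hS hc _ 4 hz,
    dirDeriv_eq_zero_of_const hS (fun z hz => dirDeriv_zero_one_eq_zero (hD z hz)) _ hz,
    τ_eq h hQ hτ ht x₀ hA, dirDeriv_tuSlice_of_eventuallyEq E.isOpen_I h.isOpen sτ ht hA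
      (g := fun s => τ (s, 0, 1)) fun s hs => τ_eq h hQ hτ hs x₀ hA] at key
  linear_combination key

/-- This is the coefficient of `b = u_xxxxx`. Since `q` contains `-β b`, the terms with `η_u` and
`ξ_u` cancel, leaving `τ_t β + τ β_t = 5 β D_x ξ`. The right side does not depend on the point or on
`m`. -/
theorem dirDeriv_ξ (h : Admissible n U) (hQ : Q ∈ Amax n U E) (hτ : τ = fun p => (Q p).1)
    (hξ : ξ = fun p => (Q p).2.1) (ht : t₀ ∈ E.I) :
    ∀ z ∈ (univ : Set ℝ) ×ˢ U, ∀ m, dirDeriv (1, m) (xuSlice ξ t₀) z =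
      (deriv (fun s => τ (s, 0, 1)) t₀ * E.β t₀ + τ (t₀, 0, 1) * deriv E.β t₀)
        / (5 * E.β t₀) := by
  rintro ⟨x₀, A⟩ ⟨-, hA⟩ m
  have h0 := determining_identity_τ h hQ (x₀ := x₀) ht hA hτ hξ rfl m 0 0
    (-(A ^ n * m + E.α t₀ * A)) (by ring)
  have h1 := determining_identity_τ h hQ (x₀ := x₀) ht hA hτ hξ rfl m 0 1
    (-(A ^ n * m + E.α t₀ * A + E.β t₀)) (by ring)
  rw [eq_div_iff (mul_ne_zero (by norm_num) (E.β_ne_zero t₀ ht))]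
  linear_combination h0 - h1

/-- The determining identity once `ξ` is known to be affine in `x` and independent of `u`. -/
theorem determining_identity_ξ (h : Admissible n U) (hQ : Q ∈ Amax n U E) {x₀ A : ℝ}
    (ht : t₀ ∈ E.I) (hA : A ∈ U) (hτ : τ = fun p => (Q p).1) (hξ : ξ = fun p => (Q p).2.1)
    (hη : η = fun p => (Q p).2.2) (m a : ℝ) {κ : ℝ}
    (hκ : ∀ z ∈ (univ : Set ℝ) ×ˢ U, ∀ m, dirDeriv (1, m) (xuSlice ξ t₀) z = κ) :
    deriv E.α t₀ * τ (t₀, 0, 1) * A + (n * A ^ (n - 1) * m + E.α t₀) * η (t₀, x₀, A)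
      + A ^ n * (dirDeriv (1, m) (xuSlice η t₀) (x₀, A) - κ * m)
      + (dirDeriv (1, 0) (tuSlice η x₀) (t₀, A)
        - (dirDeriv (0, 1) (xuSlice η t₀) (x₀, A) - deriv (fun s => τ (s, 0, 1)) t₀)
          * (A ^ n * m + E.α t₀ * A)
        - dirDeriv (1, 0) (tuSlice ξ x₀) (t₀, A) * m)
      + E.β t₀ * ((dirDeriv (1, m))^[5] (xuSlice η t₀) (x₀, A)
          + 5 * dirDeriv (1, m) (dirDeriv (0, 1) (xuSlice η t₀)) (x₀, A) * a) = 0 := by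
  have hS : IsOpen ((univ : Set ℝ) ×ˢ U) := isOpen_univ.prod h.isOpen
  have hz : (x₀, A) ∈ (univ : Set ℝ) ×ˢ U := ⟨mem_univ _, hA⟩
  have key := determining_identity_τ h hQ (x₀ := x₀) ht hA hτ hξ hη m a 0
    (-(A ^ n * m + E.α t₀ * A)) (by ring)
  have e2 : (dirDeriv (1, m))^[2] (xuSlice ξ t₀) (x₀, A) = 0 :=
    iterate_dirDeriv_eq_zero_of_const hS (fun z hz => hκ z hz m) _ 0 hz
  have e5 : (dirDeriv (1, m))^[5] (xuSlice ξ t₀) (x₀, A) = 0 :=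
    iterate_dirDeriv_eq_zero_of_const hS (fun z hz => hκ z hz m) _ 3 hz
  rw [hκ _ hz, dirDeriv_zero_one_eq_zero (hκ _ hz), e2, e5,
    dirDeriv_eq_zero_of_const hS (fun z hz => dirDeriv_zero_one_eq_zero (hκ z hz)) _ hz] at key
  linear_combination key

/-- This is the coefficient of `a = u_xxxx`: the terms with `D_x ξ_u` and `D_x² ξ` are already gone,
so only `5 β D_x η_u` is left. -/
theorem dirDeriv_η_u (h : Admissible n U) (hQ : Q ∈ Amax n U E) (hη : η = fun p => (Q p).2.2)
    (ht : t₀ ∈ E.I) :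
    ∀ z ∈ (univ : Set ℝ) ×ˢ U, ∀ m, dirDeriv (1, m) (dirDeriv (0, 1) (xuSlice η t₀)) z = 0 := by
  rintro ⟨x₀, A⟩ ⟨-, hA⟩ m
  have hκ := dirDeriv_ξ h hQ rfl rfl ht
  have h0 := determining_identity_ξ h hQ (x₀ := x₀) ht hA rfl rfl hη m 0 hκ
  have h1 := determining_identity_ξ h hQ (x₀ := x₀) ht hA rfl rfl hη m 1 hκ
  have e : E.β t₀ * dirDeriv (1, m) (dirDeriv (0, 1) (xuSlice η t₀)) (x₀, A) = 0 := by
    linear_combination (h1 - h0) / 5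
  exact (mul_eq_zero.1 e).resolve_left (E.β_ne_zero t₀ ht)

theorem η_affine (h : Admissible n U) (hQ : Q ∈ Amax n U E) (hη : η = fun p => (Q p).2.2)
    (ht : t₀ ∈ E.I) : ∃ a, (∀ z ∈ (univ : Set ℝ) ×ˢ U, dirDeriv (0, 1) (xuSlice η t₀) z = a) ∧
      ∀ x, ∀ A ∈ U, η (t₀, x, A) = a * A + (η (t₀, x, 1) - a) := by
  have sη : ContDiffOn ℝ ∞ η (dom E.I U) := by rw [hη]; exact hQ.1.snd.snd
  have hS : IsOpen ((univ : Set ℝ) ×ˢ U) := isOpen_univ.prod h.isOpen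
  have hx := contDiffOn_xuSlice sη ht
  have hu := contDiffOn_dirDeriv hS hx (0, 1)
  have ha : ∀ z ∈ (univ : Set ℝ) ×ˢ U, dirDeriv (0, 1) (xuSlice η t₀) z =
      dirDeriv (0, 1) (xuSlice η t₀) (0, 1) := fun z hz => by
    simpa using eq_add_of_dirDeriv_eq h.isOpen h.convex hu
      (dirDeriv_η_u h hQ hη ht) (x := 0) (y := z.1) (h.pos_mem 1 one_pos) hz.2
  refine ⟨_, ha, fun x A hA => ?_⟩
  set a := dirDeriv (0, 1) (xuSlice η t₀) (0, 1)
  have hd : ∀ B ∈ U, HasDerivAt (fun B => η (t₀, x, B) - a * B) 0 B := by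
    intro B hB
    have h1 := hasDerivAt_comp_curve hS hx (hasDerivAt_const B x) (hasDerivAt_id B)
      (show (x, id B) ∈ (univ : Set ℝ) ×ˢ U from ⟨mem_univ _, hB⟩)
    rw [ha _ ⟨mem_univ _, hB⟩] at h1
    have h2 := h1.sub ((hasDerivAt_id B).const_mul a)
    rw [mul_one, sub_self] at h2
    exact h2
  have e := h.isOpen.is_const_of_deriv_eq_zero h.convex.isPreconnected
    (fun B hB => (hd B hB).differentiableAt.differentiableWithinAt) (fun B hB => (hd B hB).deriv)
    hA (h.pos_mem 1 one_pos)
  linarith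

/-- Because `η_u` is constant on the slice, changing the slope `m` adds to `η` along the line only a
term linear in `x`, which the fifth derivative kills. -/
theorem iterate_dirDeriv_η (h : Admissible n U) (hQ : Q ∈ Amax n U E)
    (hη : η = fun p => (Q p).2.2) (ht : t₀ ∈ E.I) {x₀ A : ℝ} (hA : A ∈ U) (m : ℝ) :
    (dirDeriv (1, m))^[5] (xuSlice η t₀) (x₀, A) =
      (dirDeriv (1, 0))^[5] (xuSlice η t₀) (x₀, A) := by
  have sη : ContDiffOn ℝ ∞ η (dom E.I U) := by rw [hη]; exact hQ.1.snd.snd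
  have hS : IsOpen ((univ : Set ℝ) ×ˢ U) := isOpen_univ.prod h.isOpen
  have hz : (x₀, A) ∈ (univ : Set ℝ) ×ˢ U := ⟨mem_univ _, hA⟩
  have hx := contDiffOn_xuSlice sη ht
  obtain ⟨a, -, ha⟩ := η_affine h hQ hη ht
  rw [← iteratedDeriv_comp_line hS hx hz, ← iteratedDeriv_comp_line hS hx hz]
  have hev : (fun x => xuSlice η t₀ (x, A + m * (x - x₀))) =ᶠ[nhds x₀]
      fun x => xuSlice η t₀ (x, A + 0 * (x - x₀)) + a * m * (x - x₀) ^ 1 := by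
    have hc : Continuous fun x : ℝ => A + m * (x - x₀) := by fun_prop
    filter_upwards [hc.continuousAt.eventually_mem (h.isOpen.mem_nhds
      (show A + m * (x₀ - x₀) ∈ U by simpa using hA))] with x hx
    simp only [xuSlice, zero_mul, add_zero]
    rw [ha x _ hx, ha x A hA]
    ring
  have h5 := natCast_le_infty 5
  have c1 : ContDiffAt ℝ ∞ (fun x => xuSlice η t₀ (x, A + 0 * (x - x₀))) x₀ := by
    simpa using contDiffAt_comp_perturbed (r := fun _ => 0) (m := 0) hS hx hz contDiff_const rfl
  have c2 : ContDiffAt ℝ ∞ (fun x => a * m * (x - x₀) ^ 1) x₀ := by fun_prop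
  rw [hev.iteratedDeriv_eq, iteratedDeriv_fun_add (c1.of_le h5) (c2.of_le h5),
    iteratedDeriv_const_mul_field, iteratedDeriv_sub_pow_self]
  simp

/-- The slope of `ξ` with respect to `x`. -/
theorem ξ_affine (h : Admissible n U) (hQ : Q ∈ Amax n U E) (hξ : ξ = fun p => (Q p).2.1)
    (ht : t₀ ∈ E.I) {κ : ℝ}
    (hκ : ∀ z ∈ (univ : Set ℝ) ×ˢ U, ∀ m, dirDeriv (1, m) (xuSlice ξ t₀) z = κ) (x y : ℝ) {A : ℝ}
    (hA : A ∈ U) : ξ (t₀, y, A) = ξ (t₀, x, 1) + κ * (y - x) := by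
  have sξ : ContDiffOn ℝ ∞ ξ (dom E.I U) := by rw [hξ]; exact hQ.1.snd.fst
  exact eq_add_of_dirDeriv_eq h.isOpen h.convex (contDiffOn_xuSlice sξ ht) hκ
    (h.pos_mem 1 one_pos) hA

/-- Subtracting the identity at `m = 0` from that at `m = 1` removes `η_t`, the terms with `α`, and
the fifth derivative of `η`. The rest is a relation between `A ^ n`, `A ^ (n - 1)` and `1`, all of
whose coefficients must vanish. -/
theorem η_eq_and_deriv_ξ (h : Admissible n U) (hQ : Q ∈ Amax n U E) (hτ : τ = fun p => (Q p).1)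
    (hξ : ξ = fun p => (Q p).2.1) (hη : η = fun p => (Q p).2.2) (ht : t₀ ∈ E.I) {κ : ℝ}
    (hκ : ∀ z ∈ (univ : Set ℝ) ×ˢ U, ∀ m, dirDeriv (1, m) (xuSlice ξ t₀) z = κ) (x : ℝ) :
    (∀ A ∈ U, η (t₀, x, A) = (κ - deriv (fun s => τ (s, 0, 1)) t₀) / n * A) ∧
      deriv (fun s => ξ (s, x, 1)) t₀ = 0 := by
  have sξ : ContDiffOn ℝ ∞ ξ (dom E.I U) := by rw [hξ]; exact hQ.1.snd.fst
  obtain ⟨a, ha, hη'⟩ := η_affine h hQ hη ht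
  have key : ∀ A ∈ U, (n * a - κ + deriv (fun s => τ (s, 0, 1)) t₀) * A ^ n
      + n * (η (t₀, x, 1) - a) * A ^ (n - 1) + -deriv (fun s => ξ (s, x, 1)) t₀ = 0 := by
    intro A hA
    have hz : (x, A) ∈ (univ : Set ℝ) ×ˢ U := ⟨mem_univ _, hA⟩
    have h0 := determining_identity_ξ h hQ (x₀ := x) ht hA hτ hξ hη 0 0 hκ
    have h1 := determining_identity_ξ h hQ (x₀ := x) ht hA hτ hξ hη 1 0 hκ
    have hd := dirDeriv_add_smul (xuSlice η t₀) (x, A) 1 0 1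
    rw [zero_add] at hd
    have hξt : dirDeriv (1, 0) (tuSlice ξ x) (t₀, A) = deriv (fun s => ξ (s, x, 1)) t₀ := by
      refine dirDeriv_tuSlice_of_eventuallyEq E.isOpen_I h.isOpen sξ ht hA fun s hs => ?_
      simpa using ξ_affine h hQ hξ hs (dirDeriv_ξ h hQ hτ hξ hs) x x hA
    rw [iterate_dirDeriv_η h hQ hη ht hA 1, hd, hξt, ha _ hz, hη' x A hA] at h1
    rw [hξt, ha _ hz, hη' x A hA] at h0
    linear_combination h1 - h0 - n * a * h.mul_self A hA
  obtain ⟨e1, e2, e3⟩ := h.linearIndependent key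
  have hb := (mul_eq_zero.1 e2).resolve_left h.ne_zero
  refine ⟨fun A hA => ?_, neg_eq_zero.1 e3⟩
  have hn := h.ne_zero
  rw [hη' x A hA, hb, show a = (κ - deriv (fun s => τ (s, 0, 1)) t₀) / n by
    field_simp; linarith]
  ring

end Solve

theorem exists_symField_of_mem_Amax {n : ℝ} {U : Set ℝ} (h : Admissible n U) {E : Equation}
    {Q : VField} (hQ : Q ∈ Amax n U E) :
    ∃ τ c d, IsSym n E τ c ∧ Q = symField n E.I U τ c d := by
  obtain ⟨τ, hτ⟩ : ∃ τ, τ = fun p => (Q p).1 := ⟨_, rfl⟩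
  obtain ⟨ξ, hξ⟩ : ∃ ξ, ξ = fun p => (Q p).2.1 := ⟨_, rfl⟩
  obtain ⟨η, hη⟩ : ∃ η, η = fun p => (Q p).2.2 := ⟨_, rfl⟩
  have sτ : ContDiffOn ℝ ∞ τ (dom E.I U) := by rw [hτ]; exact hQ.1.fst
  have sξ : ContDiffOn ℝ ∞ ξ (dom E.I U) := by rw [hξ]; exact hQ.1.snd.fst
  have sη : ContDiffOn ℝ ∞ η (dom E.I U) := by rw [hη]; exact hQ.1.snd.snd
  have h1U := h.pos_mem 1 one_pos
  have hS : IsOpen ((univ : Set ℝ) ×ˢ U) := isOpen_univ.prod h.isOpen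
  obtain ⟨t₁, ht₁⟩ := E.nonempty_I
  have hκ := fun t ht => dirDeriv_ξ h hQ hτ hξ (t₀ := t) ht
  have slice : ∀ {f : ℝ × ℝ × ℝ → ℝ} (x : ℝ), ContDiffOn ℝ ∞ f (dom E.I U) →
      ContDiffOn ℝ ∞ (fun s => f (s, x, 1)) E.I := fun {f} x hf =>
    hf.comp (g := f) (f := fun s : ℝ => (s, x, (1 : ℝ))) (ContDiff.contDiffOn (by fun_prop))
      fun s hs => mem_dom.2 ⟨hs, h1U⟩
  have hcx : ∀ t ∈ E.I, ∀ x, ξ (t, x, 1) = ξ (t₁, x, 1) := fun t ht x =>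
    E.isOpen_I.is_const_of_deriv_eq_zero E.ordConnected_I.isPreconnected
      ((slice x sξ).differentiableOn (by simp))
      (fun s hs => (η_eq_and_deriv_ξ h hQ hτ hξ hη hs (hκ s hs) x).2) ht ht₁
  -- The slope of `ξ` in `x` read off between `x = 0` and `x = 1`; as `ξ_t = 0`, it is the same for
  -- every `t`.
  obtain ⟨c, hc⟩ : ∃ c, c = ξ (t₁, 1, 1) - ξ (t₁, 0, 1) := ⟨_, rfl⟩
  have hκc : ∀ t ∈ E.I, (deriv (fun s => τ (s, 0, 1)) t * E.β t + τ (t, 0, 1) * deriv E.β t)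
        / (5 * E.β t) = c := by
    intro t ht
    have e := ξ_affine h hQ hξ ht (hκ t ht) 0 1 h1U
    rw [hcx t ht, hcx t ht] at e
    rw [hc, e]
    ring
  have hη' : ∀ t ∈ E.I, ∀ x, ∀ A ∈ U,
      η (t, x, A) = (c - deriv (fun s => τ (s, 0, 1)) t) / n * A := fun t ht x A hA => by
    rw [(η_eq_and_deriv_ξ h hQ hτ hξ hη ht (hκ t ht) x).1 A hA, hκc t ht]
  refine ⟨fun s => τ (s, 0, 1), c, ξ (t₁, 0, 1), ⟨slice 0 sτ, fun t ht => ?_, fun t ht => ?_⟩, ?_⟩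
  · have := E.β_ne_zero t ht
    rw [← hκc t ht]
    field_simp
  · have hz : ((0 : ℝ), (1 : ℝ)) ∈ (univ : Set ℝ) ×ˢ U := ⟨mem_univ _, h1U⟩
    -- With `m = 0` and `A = 1` all that remains is the equation for `α`.
    have key := determining_identity_ξ h hQ (x₀ := 0) ht h1U hτ hξ hη 0 0 (hκ t ht)
    have hxη := contDiffOn_xuSlice sη ht
    have hline : (fun x : ℝ => xuSlice η t (x, 1 + 0 * (x - 0))) = fun _ => η (t, 0, 1) := by
      funext x
      simp only [xuSlice, zero_mul, add_zero]
      rw [hη' t ht x 1 h1U, hη' t ht 0 1 h1U]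
    have e5 : (dirDeriv (1, 0))^[5] (xuSlice η t) (0, 1) = 0 := by
      rw [← iteratedDeriv_comp_line hS hxη hz, hline]
      rw [iteratedDeriv_const]; simp
    have e1 : dirDeriv (1, 0) (xuSlice η t) (0, 1) = 0 := by
      have := iteratedDeriv_comp_line hS hxη hz 0 1
      rw [hline] at this
      simpa using this.symm
    have hτ' : HasDerivAt (deriv fun s => τ (s, 0, 1)) (deriv (deriv fun s => τ (s, 0, 1)) t) t :=
      (((contDiffOn_deriv E.isOpen_I (slice 0 sτ)).contDiffAt
        (E.isOpen_I.mem_nhds ht)).differentiableAt (by simp)).hasDerivAt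
    have et : dirDeriv (1, 0) (tuSlice η 0) (t, 1) =
        -deriv (deriv fun s => τ (s, 0, 1)) t / n := by
      rw [dirDeriv_tuSlice_of_eventuallyEq E.isOpen_I h.isOpen sη ht h1U
        fun s hs => hη' s hs 0 1 h1U]
      simp [((hτ'.const_sub c).div_const n).deriv]
    obtain ⟨a, ha, hηa⟩ := η_affine h hQ hη ht
    rw [e5, e1, et, ha _ hz, dirDeriv_eq_zero_of_const hS ha _ hz, hη' t ht 0 1 h1U] at key
    -- A second value of `u` identifies the abstract slope `a` with `(c - τ_t) / n`.
    have h2 := h.pos_mem 2 two_pos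
    have eη := hηa 0 2 h2
    rw [hη' t ht 0 2 h2, hη' t ht 0 1 h1U] at eη
    simp only [mul_zero, mul_one, Real.one_rpow] at key
    linear_combination key - E.α t * eη
  · funext p
    obtain ⟨t, x, A⟩ := p
    by_cases hp : (t, x, A) ∈ dom E.I U
    · obtain ⟨ht, hA⟩ := mem_dom.1 hp
      rw [symField_apply ht hA]
      have e1 := τ_eq h hQ hτ ht x hA
      have e2 := ξ_affine h hQ hξ ht (hκ t ht) 0 x hA
      have e3 := hη' t ht x A hA
      rw [hcx t ht, hκc t ht] at e2
      subst hτ hξ hη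
      simp only at e1 e2 e3
      ext
      · exact e1
      · simp only [e2]; ring
      · exact e3
    · rw [symField_of_notMem hp, hQ.2.1 _ hp]

theorem mem_Amax_iff {n : ℝ} {U : Set ℝ} (h : Admissible n U) {E : Equation} {Q : VField} :
    Q ∈ Amax n U E ↔ ∃ τ c d, IsSym n E τ c ∧ Q = symField n E.I U τ c d := by
  refine ⟨exists_symField_of_mem_Amax h, ?_⟩
  rintro ⟨τ, c, d, hs, rfl⟩
  exact symField_mem_Amax h hs d

/-! ### Primitives and inverses of smooth functions on intervals -/

theorem exists_primitive {I : Set ℝ} (hI : IsOpen I) (hc : I.OrdConnected) {f : ℝ → ℝ}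
    (hf : ContDiffOn ℝ ∞ f I) :
    ∃ F : ℝ → ℝ, ContDiffOn ℝ ∞ F I ∧ ∀ t ∈ I, HasDerivAt F (f t) t := by
  rcases I.eq_empty_or_nonempty with rfl | ⟨t₀, ht₀⟩
  · exact ⟨0, contDiffOn_const, by simp⟩
  have hd : ∀ t ∈ I, HasDerivAt (fun t => ∫ s in t₀..t, f s) (f t) t := by
    intro t ht
    refine intervalIntegral.integral_hasDerivAt_right ?_
      (hf.continuousOn.stronglyMeasurableAtFilter hI t ht)
      (hf.continuousOn.continuousAt (hI.mem_nhds ht))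
    exact (hf.continuousOn.mono (hc.uIcc_subset ht₀ ht)).intervalIntegrable
  refine ⟨_, (contDiffOn_infty_iff_deriv_of_isOpen hI).2
    ⟨fun t ht => (hd t ht).differentiableAt.differentiableWithinAt, ?_⟩, hd⟩
  exact hf.congr fun t ht => (hd t ht).deriv

theorem EquivTransf.deriv_ne_zero {I : Set ℝ} (g : EquivTransf I) {t : ℝ} (ht : t ∈ I) :
    deriv g.T t ≠ 0 := fun h => by simpa [h] using g.pos t ht

theorem EquivTransf.δ₁_ne_zero {I : Set ℝ} (g : EquivTransf I) (hI : I.Nonempty) : g.δ₁ ≠ 0 := by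
  obtain ⟨t, ht⟩ := hI
  exact fun h => by simpa [h] using g.pos t ht

theorem EquivTransf.hasDerivAt {I : Set ℝ} (hI : IsOpen I) (g : EquivTransf I) {t : ℝ}
    (ht : t ∈ I) : HasDerivAt g.T (deriv g.T t) t :=
  ((g.smooth_T.contDiffAt (hI.mem_nhds ht)).differentiableAt (by simp)).hasDerivAt

theorem EquivTransf.hasDerivAt_deriv {I : Set ℝ} (hI : IsOpen I) (g : EquivTransf I) {t : ℝ}
    (ht : t ∈ I) : HasDerivAt (deriv g.T) (deriv (deriv g.T) t) t :=
  (((contDiffOn_deriv hI g.smooth_T).contDiffAt (hI.mem_nhds ht)).differentiableAt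
    (by simp)).hasDerivAt

theorem EquivTransf.injOn {I : Set ℝ} (hI : IsOpen I) (hc : I.OrdConnected) (g : EquivTransf I) :
    InjOn g.T I := by
  have key : ∀ a ∈ I, ∀ b ∈ I, a < b → g.T a ≠ g.T b := by
    intro a ha b hb hab h
    have hs := hc.out ha hb
    obtain ⟨c, hcm, h0⟩ := exists_hasDerivAt_eq_zero hab
      (fun t ht => (g.hasDerivAt hI (hs ht)).continuousAt.continuousWithinAt) h
      fun t ht => g.hasDerivAt hI (hs (Ioo_subset_Icc_self ht))
    exact g.deriv_ne_zero (hs (Ioo_subset_Icc_self hcm)) h0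
  intro a ha b hb h
  rcases lt_trichotomy a b with hab | hab | hab
  · exact absurd h (key a ha b hb hab)
  · exact hab
  · exact absurd h.symm (key b hb a ha hab)

theorem EquivTransf.isOpen_image {I : Set ℝ} (hI : IsOpen I) (g : EquivTransf I) :
    IsOpen (g.T '' I) := by
  rw [isOpen_iff_mem_nhds]
  rintro _ ⟨t, ht, rfl⟩
  have hs : HasStrictDerivAt g.T (deriv g.T t) t :=
    (g.smooth_T.contDiffAt (hI.mem_nhds ht)).hasStrictDerivAt (by simp)
  rw [← hs.map_nhds_eq (g.deriv_ne_zero ht)]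
  exact Filter.image_mem_map (hI.mem_nhds ht)

/-- The set-theoretic inverse agrees near each image point with the local inverse of the inverse
function theorem, by injectivity of `T` on `I`; smoothness is therefore local. -/
theorem EquivTransf.exists_inverse {I : Set ℝ} (hI : IsOpen I) (hc : I.OrdConnected)
    (g : EquivTransf I) :
    ∃ S : ℝ → ℝ, (∀ t ∈ I, S (g.T t) = t) ∧ ContDiffOn ℝ ∞ S (g.T '' I) := by
  have hinj := g.injOn hI hc
  refine ⟨Function.invFunOn g.T I, fun t ht => hinj.leftInvOn_invFunOn ht, ?_⟩
  rintro _ ⟨t, ht, rfl⟩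
  have hcd := g.smooth_T.contDiffAt (hI.mem_nhds ht)
  have hne := g.deriv_ne_zero ht
  have hF : HasFDerivAt g.T
      ((ContinuousLinearEquiv.unitsEquivAut ℝ (Units.mk0 _ hne) : ℝ ≃L[ℝ] ℝ) : ℝ →L[ℝ] ℝ) t :=
    (g.hasDerivAt hI ht).hasFDerivAt_equiv hne
  have hn : (∞ : WithTop ℕ∞) ≠ 0 := by simp
  have hL := hcd.to_localInverse hF hn
  refine (hL.congr_of_eventuallyEq ?_).contDiffWithinAt
  have hst := hcd.hasStrictFDerivAt' hF hn
  have hr : ∀ᶠ y in nhds (g.T t), g.T (hcd.localInverse hF hn y) = y :=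
    hst.eventually_right_inverse
  have hl : hcd.localInverse hF hn (g.T t) = t := hst.localInverse_apply_image
  have hm : ∀ᶠ y in nhds (g.T t), hcd.localInverse hF hn y ∈ I :=
    hL.continuousAt.eventually_mem (hI.mem_nhds (by rwa [hl]))
  filter_upwards [hr, hm] with y hy hyI
  conv_lhs => rw [← hy]
  exact hinj.leftInvOn_invFunOn hyI

/-- Every transformation maps the equation to an equation of the class. -/
theorem EquivTransf.exists_maps {n : ℝ} (hn : n ≠ 0) (E : Equation) (g : EquivTransf E.I) :
    ∃ E', g.Maps n E E' := by
  obtain ⟨S, hS, hSs⟩ := g.exists_inverse E.isOpen_I E.ordConnected_I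
  have hmap : MapsTo S (g.T '' E.I) E.I := by
    rintro _ ⟨t, ht, rfl⟩
    rwa [hS t ht]
  have s1 := contDiffOn_deriv E.isOpen_I g.smooth_T
  have s2 := contDiffOn_deriv E.isOpen_I s1
  have hpre : IsPreconnected (g.T '' E.I) :=
    E.ordConnected_I.isPreconnected.image _ g.smooth_T.continuousOn
  refine ⟨⟨g.T '' E.I, g.isOpen_image E.isOpen_I, hpre.ordConnected, E.nonempty_I.image _,
    fun s => E.α (S s) / deriv g.T (S s)
      + deriv (deriv g.T) (S s) / (n * deriv g.T (S s) ^ 2),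
    fun s => g.δ₁ ^ 5 / deriv g.T (S s) * E.β (S s),
    ContDiffOn.comp (g := fun t => E.α t / deriv g.T t
        + deriv (deriv g.T) t / (n * deriv g.T t ^ 2))
      ((E.smooth_α.div s1 fun t ht => g.deriv_ne_zero ht).add
        (s2.div (contDiffOn_const.mul (s1.pow 2)) fun t ht =>
          mul_ne_zero hn (pow_ne_zero 2 (g.deriv_ne_zero ht)))) hSs hmap,
    ContDiffOn.comp (g := fun t => g.δ₁ ^ 5 / deriv g.T t * E.β t)
      ((contDiffOn_const.div s1 fun t ht => g.deriv_ne_zero ht).mul E.smooth_β) hSs hmap, ?_⟩,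
    rfl, fun t ht => by simp [hS t ht]⟩
  rintro _ ⟨t, ht, rfl⟩
  rw [hS t ht]
  exact mul_ne_zero (div_ne_zero (pow_ne_zero _ (g.δ₁_ne_zero E.nonempty_I))
    (g.deriv_ne_zero ht)) (E.β_ne_zero t ht)

theorem GEquiv.trans {n : ℝ} (hn : n ≠ 0) {E E' E'' : Equation} (h₁ : GEquiv n E E')
    (h₂ : GEquiv n E' E'') : GEquiv n E E'' := by
  obtain ⟨g, hgI, hg⟩ := h₁
  obtain ⟨k, hkI, hk⟩ := h₂
  have hmem : ∀ t ∈ E.I, g.T t ∈ E'.I := fun t ht => hgI ▸ mem_image_of_mem _ ht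
  have d1 : ∀ t ∈ E.I, HasDerivAt (k.T ∘ g.T) (deriv k.T (g.T t) * deriv g.T t) t := fun t ht =>
    (k.hasDerivAt E'.isOpen_I (hmem t ht)).comp t (g.hasDerivAt E.isOpen_I ht)
  have d2 : ∀ t ∈ E.I, deriv (deriv (k.T ∘ g.T)) t =
      deriv (deriv k.T) (g.T t) * deriv g.T t * deriv g.T t
        + deriv k.T (g.T t) * deriv (deriv g.T) t := by
    intro t ht
    have he : deriv (k.T ∘ g.T) =ᶠ[nhds t] fun t => deriv k.T (g.T t) * deriv g.T t := by
      filter_upwards [E.isOpen_I.mem_nhds ht] with s hs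
      exact (d1 s hs).deriv
    rw [he.deriv_eq]
    exact (((k.hasDerivAt_deriv E'.isOpen_I (hmem t ht)).comp t (g.hasDerivAt E.isOpen_I ht)).mul
      (g.hasDerivAt_deriv E.isOpen_I ht)).deriv
  -- The composite point transformation has shift `k.δ₁ * g.δ₂ + k.δ₂`, but the coefficients do not
  -- see the shift, so any value serves.
  refine ⟨⟨k.T ∘ g.T, k.δ₁ * g.δ₁, k.δ₂,
    k.smooth_T.comp g.smooth_T hmem, fun t ht => ?_⟩, ?_, fun t ht => ?_⟩
  · rw [(d1 t ht).deriv]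
    have := mul_pos (k.pos _ (hmem t ht)) (g.pos t ht)
    linarith
  · rw [image_comp, ← hgI, hkI]
  · have n1 := g.deriv_ne_zero ht
    have n2 := k.deriv_ne_zero (hmem t ht)
    simp only [Function.comp_apply]
    rw [(hk _ (hmem t ht)).1, (hk _ (hmem t ht)).2, (hg t ht).1, (hg t ht).2,
      show deriv (k.T ∘ g.T) t = _ from (d1 t ht).deriv, d2 t ht]
    constructor
    · field_simp
      ring
    · field_simp

/-- Vanishing of the new `α` means `T_tt / T_t = -n α`, solved by two quadratures: `T_t = exp(-n ∫
α)`, which is positive, so `δ₁ = 1` is admissible. -/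
theorem exists_gauge {n : ℝ} (hn : n ≠ 0) (E : Equation) :
    ∃ E', GEquiv n E E' ∧ ∀ t ∈ E'.I, E'.α t = 0 := by
  obtain ⟨A, hA, hAd⟩ := exists_primitive E.isOpen_I E.ordConnected_I E.smooth_α
  obtain ⟨T, hT, hTd⟩ := exists_primitive E.isOpen_I E.ordConnected_I
    (f := fun t => Real.exp (-n * A t)) (contDiffOn_const.mul hA).exp
  obtain ⟨g, hg⟩ : ∃ g : EquivTransf E.I, g.T = T :=
    ⟨⟨T, 1, 0, hT, fun t ht => by rw [(hTd t ht).deriv, one_mul]; exact Real.exp_pos _⟩, rfl⟩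
  obtain ⟨E', hE'⟩ := g.exists_maps hn E
  refine ⟨E', ⟨g, hE'⟩, fun s hs => ?_⟩
  rw [hE'.1] at hs
  obtain ⟨t, ht, rfl⟩ := hs
  have he : deriv T =ᶠ[nhds t] fun t => Real.exp (-n * A t) := by
    filter_upwards [E.isOpen_I.mem_nhds ht] with s hs
    exact (hTd s hs).deriv
  rw [(hE'.2 t ht).1, hg, he.deriv_eq, he.eq_of_nhds, (((hAd t ht).const_mul (-n)).exp).deriv]
  have := Real.exp_pos (-n * A t)
  field_simp
  ring

/-! ### Transformation of the symmetries -/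

theorem hasDerivAt_of_contDiffOn {I : Set ℝ} (hI : IsOpen I) {τ : ℝ → ℝ}
    (hτ : ContDiffOn ℝ ∞ τ I) {t : ℝ} (ht : t ∈ I) : HasDerivAt τ (deriv τ t) t :=
  ((hτ.contDiffAt (hI.mem_nhds ht)).differentiableAt (by simp)).hasDerivAt

section Transport

variable {n : ℝ} {E E' : Equation} {g : EquivTransf E.I} {τ τ' : ℝ → ℝ}

theorem EquivTransf.Maps.mem (hg : g.Maps n E E') {t : ℝ} (ht : t ∈ E.I) : g.T t ∈ E'.I :=
  hg.1 ▸ mem_image_of_mem _ ht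

theorem deriv_of_transport (hg : g.Maps n E E') (hτ : ContDiffOn ℝ ∞ τ E.I)
    (hτ' : ContDiffOn ℝ ∞ τ' E'.I) (h : ∀ t ∈ E.I, τ t * deriv g.T t = τ' (g.T t)) {t : ℝ}
    (ht : t ∈ E.I) : deriv τ t * deriv g.T t + τ t * deriv (deriv g.T) t =
      deriv τ' (g.T t) * deriv g.T t := by
  have h1 := (hasDerivAt_of_contDiffOn E.isOpen_I hτ ht).mul (g.hasDerivAt_deriv E.isOpen_I ht)
  have h2 := (hasDerivAt_of_contDiffOn E'.isOpen_I hτ' (hg.mem ht)).comp t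
    (g.hasDerivAt E.isOpen_I ht)
  have he : τ * deriv g.T =ᶠ[nhds t] τ' ∘ g.T := by
    filter_upwards [E.isOpen_I.mem_nhds ht] with s hs
    exact h s hs
  exact h1.unique (h2.congr_of_eventuallyEq he)

/-- The factor `T_t` gained by `τ` cancels the one lost by `β`, so `δ₁⁵ τβ = (τ'β') ∘ T`;
differentiate this. -/
theorem transport_β (hg : g.Maps n E E') (hτ : ContDiffOn ℝ ∞ τ E.I)
    (hτ' : ContDiffOn ℝ ∞ τ' E'.I) (h : ∀ t ∈ E.I, τ t * deriv g.T t = τ' (g.T t)) {t : ℝ}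
    (ht : t ∈ E.I) : g.δ₁ ^ 5 * (deriv τ t * E.β t + τ t * deriv E.β t) =
      (deriv τ' (g.T t) * E'.β (g.T t) + τ' (g.T t) * deriv E'.β (g.T t)) * deriv g.T t := by
  have h1 := ((hasDerivAt_of_contDiffOn E.isOpen_I hτ ht).mul (E.hasDerivAt_β ht)).const_mul
    (g.δ₁ ^ 5)
  have h2 := ((hasDerivAt_of_contDiffOn E'.isOpen_I hτ' (hg.mem ht)).mul
    (E'.hasDerivAt_β (hg.mem ht))).comp t (g.hasDerivAt E.isOpen_I ht)
  have he : (fun s => g.δ₁ ^ 5 * (τ * E.β) s) =ᶠ[nhds t] (τ' * E'.β) ∘ g.T := by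
    filter_upwards [E.isOpen_I.mem_nhds ht] with s hs
    have := g.deriv_ne_zero hs
    simp only [Pi.mul_apply, Function.comp_apply]
    rw [(hg.2 s hs).2, ← h s hs]
    field_simp
  exact h1.unique (h2.congr_of_eventuallyEq he)

/-- The shift of `α` by `T_tt / (n T_t²)` compensates the second derivative of `T` in `τ'_t`, so `τα
- τ_t / n` is invariant; differentiate this. -/
theorem transport_α (hn : n ≠ 0) (hg : g.Maps n E E') (hτ : ContDiffOn ℝ ∞ τ E.I)
    (hτ' : ContDiffOn ℝ ∞ τ' E'.I) (h : ∀ t ∈ E.I, τ t * deriv g.T t = τ' (g.T t)) {t : ℝ}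
    (ht : t ∈ E.I) : deriv τ t * E.α t + τ t * deriv E.α t - deriv (deriv τ) t / n =
      (deriv τ' (g.T t) * E'.α (g.T t) + τ' (g.T t) * deriv E'.α (g.T t)
        - deriv (deriv τ') (g.T t) / n) * deriv g.T t := by
  have h1 := ((hasDerivAt_of_contDiffOn E.isOpen_I hτ ht).mul (E.hasDerivAt_α ht)).sub
    ((hasDerivAt_of_contDiffOn E.isOpen_I (contDiffOn_deriv E.isOpen_I hτ) ht).div_const n)
  have h2 := (((hasDerivAt_of_contDiffOn E'.isOpen_I hτ' (hg.mem ht)).mul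
    (E'.hasDerivAt_α (hg.mem ht))).sub ((hasDerivAt_of_contDiffOn E'.isOpen_I
      (contDiffOn_deriv E'.isOpen_I hτ') (hg.mem ht)).div_const n)).comp t
    (g.hasDerivAt E.isOpen_I ht)
  have he : (τ * E.α - fun s => deriv τ s / n) =ᶠ[nhds t]
      (τ' * E'.α - fun s => deriv τ' s / n) ∘ g.T := by
    filter_upwards [E.isOpen_I.mem_nhds ht] with s hs
    have hne := g.deriv_ne_zero hs
    have hd := deriv_of_transport hg hτ hτ' h hs
    simp only [Pi.mul_apply, Pi.sub_apply, Function.comp_apply]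
    rw [(hg.2 s hs).1, ← h s hs, show deriv τ' (g.T s) =
      deriv τ s + τ s * deriv (deriv g.T) s / deriv g.T s by field_simp; linarith]
    field_simp
    ring
  exact h1.unique (h2.congr_of_eventuallyEq he)

theorem isSym_iff_of_transport (hn : n ≠ 0) (hg : g.Maps n E E') (hτ : ContDiffOn ℝ ∞ τ E.I)
    (hτ' : ContDiffOn ℝ ∞ τ' E'.I) (h : ∀ t ∈ E.I, τ t * deriv g.T t = τ' (g.T t)) {c : ℝ} :
    IsSym n E τ c ↔ IsSym n E' τ' c := by
  have hδ : g.δ₁ ^ 5 ≠ 0 := pow_ne_zero _ (g.δ₁_ne_zero E.nonempty_I)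
  have eβ : ∀ t ∈ E.I, deriv g.T t * E'.β (g.T t) = g.δ₁ ^ 5 * E.β t := fun t ht => by
    have := g.deriv_ne_zero ht
    rw [(hg.2 t ht).2]
    field_simp
  constructor
  · intro hs
    refine ⟨hτ', fun s hs' => ?_, fun s hs' => ?_⟩ <;> rw [hg.1] at hs' <;>
      obtain ⟨t, ht, rfl⟩ := hs'
    · have e := transport_β hg hτ hτ' h ht
      rw [hs.eq_β t ht] at e
      refine mul_right_cancel₀ (g.deriv_ne_zero ht) ?_
      linear_combination -e - 5 * c * eβ t ht
    · have e := transport_α hn hg hτ hτ' h ht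
      rw [hs.eq_α t ht, sub_self] at e
      exact sub_eq_zero.1 ((mul_eq_zero.1 e.symm).resolve_right (g.deriv_ne_zero ht))
  · intro hs
    refine ⟨hτ, fun t ht => ?_, fun t ht => ?_⟩
    · have e := transport_β hg hτ hτ' h ht
      rw [hs.eq_β _ (hg.mem ht)] at e
      refine mul_left_cancel₀ hδ ?_
      linear_combination e + 5 * c * eβ t ht
    · have e := transport_α hn hg hτ hτ' h ht
      rw [hs.eq_α _ (hg.mem ht), sub_self, zero_mul] at e
      exact sub_eq_zero.1 e

/-- The pullback of the component `τ'`. -/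
theorem exists_pull (hg : g.Maps n E E') (hτ' : ContDiffOn ℝ ∞ τ' E'.I) :
    ∃ τ, ContDiffOn ℝ ∞ τ E.I ∧ ∀ t ∈ E.I, τ t * deriv g.T t = τ' (g.T t) :=
  ⟨fun t => τ' (g.T t) / deriv g.T t, (hτ'.comp g.smooth_T fun _ ht => hg.mem ht).div
    (contDiffOn_deriv E.isOpen_I g.smooth_T) fun _ ht => g.deriv_ne_zero ht,
    fun _ ht => div_mul_cancel₀ _ (g.deriv_ne_zero ht)⟩

/-- The pushforward of the component `τ`. -/
theorem exists_push (hg : g.Maps n E E') (hτ : ContDiffOn ℝ ∞ τ E.I) :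
    ∃ τ', ContDiffOn ℝ ∞ τ' E'.I ∧ ∀ t ∈ E.I, τ t * deriv g.T t = τ' (g.T t) := by
  obtain ⟨S, hS, hSs⟩ := g.exists_inverse E.isOpen_I E.ordConnected_I
  refine ⟨fun s => τ (S s) * deriv g.T (S s), ?_, fun t ht => by simp only [hS t ht]⟩
  rw [hg.1]
  refine ContDiffOn.comp (g := fun t => τ t * deriv g.T t)
    (hτ.mul (contDiffOn_deriv E.isOpen_I g.smooth_T)) hSs ?_
  rintro _ ⟨t, ht, rfl⟩
  rwa [hS t ht]

/-- The Jacobian of the point transformation; its off-diagonal entry is the logarithmic derivative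
`-T_tt / (n T_t)` of the factor `(δ₁ / T_t)^(1/n)`. -/
theorem EquivTransf.hasFDerivAt_toFun {I : Set ℝ} (hI : IsOpen I) (g : EquivTransf I) {t : ℝ}
    (ht : t ∈ I) (x u : ℝ) :
    ∃ M : (ℝ × ℝ × ℝ) →L[ℝ] (ℝ × ℝ × ℝ), HasFDerivAt (g.toFun n) M (t, x, u) ∧
      ∀ a b v : ℝ, M (a, b, v) = (deriv g.T t * a, g.δ₁ * b,
        (g.δ₁ / deriv g.T t) ^ (1 / n) *
          (v - u * (deriv (deriv g.T) t / (n * deriv g.T t)) * a)) := by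
  have hne := g.deriv_ne_zero ht
  have hpos : 0 < g.δ₁ / deriv g.T t := by
    have := g.pos t ht
    rcases mul_pos_iff.1 this with ⟨h1, h2⟩ | ⟨h1, h2⟩
    · exact div_pos h1 h2
    · exact div_pos_of_neg_of_neg h1 h2
  have hs : HasDerivAt (fun s => (g.δ₁ / deriv g.T s) ^ (1 / n))
      (-((g.δ₁ / deriv g.T t) ^ (1 / n) * (deriv (deriv g.T) t / (n * deriv g.T t)))) t := by
    have h1 := (((hasDerivAt_const t g.δ₁).div (g.hasDerivAt_deriv hI ht) hne)).rpow_const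
      (p := 1 / n) (Or.inl hpos.ne')
    rw [Pi.div_apply, Real.rpow_sub_one hpos.ne'] at h1
    have hδ : g.δ₁ ≠ 0 := fun h0 => by simp [h0] at hpos
    refine h1.congr_deriv ?_
    simp only [div_eq_mul_inv, mul_inv_rev, inv_inv]
    field_simp
    ring
  have h1 : HasFDerivAt (fun p : ℝ × ℝ × ℝ => p.1) (ContinuousLinearMap.fst ℝ ℝ (ℝ × ℝ)) (t, x, u) :=
    hasFDerivAt_fst
  have h2 : HasFDerivAt (fun p : ℝ × ℝ × ℝ => p.2.1)
      ((ContinuousLinearMap.fst ℝ ℝ ℝ).comp (ContinuousLinearMap.snd ℝ ℝ (ℝ × ℝ))) (t, x, u) :=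
    ((ContinuousLinearMap.fst ℝ ℝ ℝ).comp (ContinuousLinearMap.snd ℝ ℝ (ℝ × ℝ))).hasFDerivAt
  have h3 : HasFDerivAt (fun p : ℝ × ℝ × ℝ => p.2.2)
      ((ContinuousLinearMap.snd ℝ ℝ ℝ).comp (ContinuousLinearMap.snd ℝ ℝ (ℝ × ℝ))) (t, x, u) :=
    ((ContinuousLinearMap.snd ℝ ℝ ℝ).comp (ContinuousLinearMap.snd ℝ ℝ (ℝ × ℝ))).hasFDerivAt
  have key := ((g.hasDerivAt hI ht).comp_hasFDerivAt (t, x, u) h1).prodMk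
    (((h2.const_mul g.δ₁).add_const g.δ₂).prodMk ((hs.comp_hasFDerivAt (t, x, u) h1).mul h3))
  refine ⟨_, key, fun a b v => ?_⟩
  simp
  ring

/-- The constant `c` is kept because `x` is changed affinely. The relation between `d` and `d'` is
`δ₁ (c x + d) = c (δ₁ x + δ₂) + d'`. -/
theorem restrict_pullback_symField {U : Set ℝ} (h : Admissible n U) (hg : g.Maps n E E')
    (hτ : ContDiffOn ℝ ∞ τ E.I) (hτ' : ContDiffOn ℝ ∞ τ' E'.I)
    (hT : ∀ t ∈ E.I, τ t * deriv g.T t = τ' (g.T t)) {c d d' : ℝ} (hd : g.δ₁ * d = c * g.δ₂ + d') :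
    restrict (dom E.I U) (VectorField.pullback ℝ (g.toFun n) (symField n E'.I U τ' c d')) =
      symField n E.I U τ c d := by
  funext p
  by_cases hp : p ∈ dom E.I U
  · obtain ⟨t, x, u⟩ := p
    obtain ⟨ht, hu⟩ := mem_dom.1 hp
    obtain ⟨M, hM, hMv⟩ := g.hasFDerivAt_toFun (n := n) E.isOpen_I ht x u
    have hn := h.ne_zero
    have hne := g.deriv_ne_zero ht
    have hδ := g.δ₁_ne_zero E.nonempty_I
    have hpos : 0 < g.δ₁ / deriv g.T t := by
      rcases mul_pos_iff.1 (g.pos t ht) with ⟨h1, h2⟩ | ⟨h1, h2⟩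
      · exact div_pos h1 h2
      · exact div_pos_of_neg_of_neg h1 h2
    have hs := Real.rpow_pos_of_pos hpos (1 / n)
    -- The Jacobian is triangular with nonzero diagonal entries, and in finite dimension injectivity
    -- gives invertibility.
    have hinj : Function.Injective (M : (ℝ × ℝ × ℝ) →ₗ[ℝ] (ℝ × ℝ × ℝ)) := by
      rw [injective_iff_map_eq_zero]
      rintro ⟨a, b, v⟩ h0
      rw [ContinuousLinearMap.coe_coe, hMv] at h0
      simp only [Prod.mk_eq_zero, mul_eq_zero, hne, hδ, hs.ne', false_or] at h0
      obtain ⟨rfl, rfl, h0⟩ := h0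
      simpa using h0
    have hinv : M.IsInvertible := by
      refine ⟨(LinearEquiv.ofInjectiveEndo (M : (ℝ × ℝ × ℝ) →ₗ[ℝ] (ℝ × ℝ × ℝ))
        hinj).toContinuousLinearEquiv, ?_⟩
      ext <;> rfl
    have hd1 := deriv_of_transport hg hτ hτ' hT ht
    rw [restrict, Set.indicator_of_mem hp, VectorField.pullback, hM.fderiv, hinv.inverse_apply_eq,
      symField_apply ht hu, hMv]
    have hmem := h.mul_mem _ hs _ hu
    have e : g.toFun n (t, x, u) =
      (g.T t, g.δ₁ * x + g.δ₂, (g.δ₁ / deriv g.T t) ^ (1 / n) * u) := rfl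
    rw [e, symField_apply (hg.mem ht) hmem, ← hT t ht, show deriv τ' (g.T t) =
      deriv τ t + τ t * deriv (deriv g.T) t / deriv g.T t by field_simp; linarith]
    refine Prod.ext (mul_comm _ _) (Prod.ext ?_ ?_)
    · simp only
      linear_combination -hd
    · simp only
      field_simp
      ring
  · rw [symField_of_notMem hp, restrict, Set.indicator_of_notMem hp]

theorem Amax_eq_image {U : Set ℝ} (h : Admissible n U) (hg : g.Maps n E E') :
    Amax n U E = (fun V => restrict (dom E.I U) (VectorField.pullback ℝ (g.toFun n) V)) ''
      Amax n U E' := by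
  have hδ := g.δ₁_ne_zero E.nonempty_I
  ext Q
  simp only [mem_image, mem_Amax_iff h]
  constructor
  · rintro ⟨τ, c, d, hs, rfl⟩
    obtain ⟨τ', hτ', hT⟩ := exists_push hg hs.smooth
    exact ⟨_, ⟨τ', c, g.δ₁ * d - c * g.δ₂,
      (isSym_iff_of_transport h.ne_zero hg hs.smooth hτ' hT).1 hs, rfl⟩,
      restrict_pullback_symField h hg hs.smooth hτ' hT (by ring)⟩
  · rintro ⟨_, ⟨τ', c, d', hs, rfl⟩, rfl⟩
    obtain ⟨τ, hτ, hT⟩ := exists_pull hg hs.smooth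
    exact ⟨τ, c, (c * g.δ₂ + d') / g.δ₁,
      (isSym_iff_of_transport h.ne_zero hg hτ hs.smooth hT).2 hs,
      restrict_pullback_symField h hg hτ hs.smooth hT (by field_simp)⟩

end Transport

/-! ### Equations with `α = 0` -/

theorem affine_eq_zero {I : Set ℝ} (hI : IsOpen I) (hne : I.Nonempty) {a b : ℝ}
    (h : ∀ t ∈ I, a * t + b = 0) : a = 0 ∧ b = 0 := by
  obtain ⟨t, ht⟩ := hne
  obtain ⟨s, hs, hst⟩ : ∃ s ∈ I, s ≠ t := by
    have := (eventually_nhdsWithin_of_eventually_nhds (s := {t}ᶜ) (hI.mem_nhds ht)).and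
      self_mem_nhdsWithin
    obtain ⟨s, hs⟩ := this.exists
    exact ⟨s, hs.1, hs.2⟩
  have h1 := h t ht
  have h2 := h s hs
  have ha : a = 0 := by
    have : a * (s - t) = 0 := by linear_combination h2 - h1
    exact (mul_eq_zero.1 this).resolve_right (sub_ne_zero.2 hst)
  subst ha
  exact ⟨rfl, by linarith⟩

theorem deriv_eqOn {I : Set ℝ} (hI : IsOpen I) {f g : ℝ → ℝ} (h : EqOn f g I) :
    EqOn (deriv f) (deriv g) I := fun t ht => by
  have he : f =ᶠ[nhds t] g := by
    filter_upwards [hI.mem_nhds ht] with s hs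
    exact h hs
  exact he.deriv_eq

theorem deriv_affine (a b : ℝ) : deriv (fun t : ℝ => a * t + b) = fun _ => a := by
  funext t
  simp

theorem symField_congr {n : ℝ} {I U : Set ℝ} (hI : IsOpen I) {τ τ' : ℝ → ℝ} (h : EqOn τ τ' I)
    (c d : ℝ) : symField n I U τ c d = symField n I U τ' c d := by
  funext p
  by_cases hp : p ∈ dom I U
  · obtain ⟨t, x, u⟩ := p
    obtain ⟨ht, hu⟩ := mem_dom.1 hp
    rw [symField_apply ht hu, symField_apply ht hu, h ht, deriv_eqOn hI h ht]
  · rw [symField_of_notMem hp, symField_of_notMem hp]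

/-- With `α = 0` the second determining equation is `τ_tt = 0`, so `τ` is affine on the interval and
only the equation for `β` is left. -/
theorem isSym_iff_of_gauge {n : ℝ} (hn : n ≠ 0) {E : Equation} (hα : ∀ t ∈ E.I, E.α t = 0)
    {τ : ℝ → ℝ} {c : ℝ} : IsSym n E τ c ↔ ∃ a b, EqOn τ (fun t => a * t + b) E.I ∧
      ∀ t ∈ E.I, a * E.β t + (a * t + b) * deriv E.β t = 5 * c * E.β t := by
  have hα' : ∀ t ∈ E.I, deriv E.α t = 0 := fun t ht => by
    rw [deriv_eqOn E.isOpen_I (g := fun _ => 0) hα ht, deriv_const]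
  constructor
  · intro hs
    have hd : ∀ t ∈ E.I, deriv (deriv τ) t = 0 := fun t ht => by
      have := hs.eq_α t ht
      rw [hα t ht, hα' t ht, mul_zero, mul_zero, add_zero] at this
      exact (div_eq_zero_iff.1 this.symm).resolve_right hn
    have hpre := E.ordConnected_I.isPreconnected
    have hs' := contDiffOn_deriv E.isOpen_I hs.smooth
    obtain ⟨a, ha⟩ := E.isOpen_I.exists_is_const_of_deriv_eq_zero hpre
      (hs'.differentiableOn (by simp)) hd
    obtain ⟨b, hb⟩ := E.isOpen_I.exists_eq_add_of_deriv_eq (g := fun t => a * t) hpre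
      (hs.smooth.differentiableOn (by simp)) (by fun_prop) (fun t ht => by
        rw [ha t ht]; simp)
    refine ⟨a, b, hb, fun t ht => ?_⟩
    have := hs.eq_β t ht
    rwa [ha t ht, hb ht] at this
  · rintro ⟨a, b, hτ, hβ⟩
    have h1 := deriv_eqOn E.isOpen_I hτ
    have h2 := deriv_eqOn E.isOpen_I h1
    rw [deriv_affine] at h1 h2
    refine ⟨ContDiffOn.congr (f := fun t => a * t + b) (ContDiff.contDiffOn (by fun_prop)) hτ,
      fun t ht => ?_, fun t ht => ?_⟩
    · rw [h1 ht, hτ ht]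
      exact hβ t ht
    · rw [h2 ht, hα t ht, hα' t ht]
      simp

theorem mem_Amax_iff_of_gauge {n : ℝ} {U : Set ℝ} (h : Admissible n U) {E : Equation}
    (hα : ∀ t ∈ E.I, E.α t = 0) {Q : VField} : Q ∈ Amax n U E ↔ ∃ a b c d,
      (∀ t ∈ E.I, a * E.β t + (a * t + b) * deriv E.β t = 5 * c * E.β t) ∧
        Q = symField n E.I U (fun t => a * t + b) c d := by
  rw [mem_Amax_iff h]
  constructor
  · rintro ⟨τ, c, d, hs, rfl⟩
    obtain ⟨a, b, hτ, hβ⟩ := (isSym_iff_of_gauge h.ne_zero hα).1 hs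
    exact ⟨a, b, c, d, hβ, symField_congr E.isOpen_I hτ c d⟩
  · rintro ⟨a, b, c, d, hβ, rfl⟩
    exact ⟨_, c, d, (isSym_iff_of_gauge h.ne_zero hα).2 ⟨a, b, fun _ _ => rfl, hβ⟩, rfl⟩

/-! ### The trivial algebra -/

theorem isSym_zero (n : ℝ) (E : Equation) : IsSym n E (fun _ => 0) 0 := by
  constructor <;> simp [contDiffOn_const]

theorem symField_zero (n : ℝ) (I U : Set ℝ) (d : ℝ) :
    symField n I U (fun _ => 0) 0 d = d • restrict (dom I U) dX := by
  funext p
  by_cases hp : p ∈ dom I U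
  · simp [symField, restrict, hp, dX]
  · simp [symField, restrict, hp]

theorem IsSym.eq_zero {n : ℝ} {E : Equation} {τ : ℝ → ℝ} {c : ℝ} (hs : IsSym n E τ c)
    (hτ : ∀ t ∈ E.I, τ t = 0) : c = 0 := by
  obtain ⟨t, ht⟩ := E.nonempty_I
  have := hs.eq_β t ht
  rw [hτ t ht, deriv_eqOn E.isOpen_I (g := fun _ => 0) hτ ht, deriv_const] at this
  simpa [E.β_ne_zero t ht] using this.symm

theorem symField_ext_iff {n : ℝ} {I U : Set ℝ} (hI : I.Nonempty) (h1 : (1 : ℝ) ∈ U)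
    {τ τ' : ℝ → ℝ} {c c' d d' : ℝ} (h : symField n I U τ c d = symField n I U τ' c' d') :
    EqOn τ τ' I ∧ c = c' ∧ d = d' := by
  obtain ⟨t, ht⟩ := hI
  have e0 := congrFun h (t, 0, 1)
  have e1 := congrFun h (t, 1, 1)
  rw [symField_apply ht h1, symField_apply ht h1] at e0 e1
  simp only [Prod.mk.injEq, mul_zero, zero_add, mul_one] at e0 e1
  refine ⟨fun s hs => ?_, by linarith, e0.2.1⟩
  have e := congrFun h (s, 0, 1)
  rw [symField_apply hs h1, symField_apply hs h1] at e
  exact (Prod.mk.inj e).1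

theorem isBasisOn_dX_iff {n : ℝ} {I U : Set ℝ} (h : Admissible n U) (hI : I.Nonempty)
    {A : Set VField} : IsBasisOn (dom I U) ![dX] A ↔
      ∀ Q, Q ∈ A ↔ ∃ d, Q = symField n I U (fun _ => 0) 0 d := by
  have hz : restrict (dom I U) dX ≠ 0 := by
    obtain ⟨t, ht⟩ := hI
    intro h0
    have := congrFun h0 (t, 0, 1)
    simp [restrict, mem_dom.2 ⟨ht, h.pos_mem 1 one_pos⟩, dX] at this
  have hli : LinearIndependent ℝ (fun i : Fin 1 => restrict (dom I U) ((![dX] : Fin 1 → VField) i)) :=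
    linearIndependent_unique_iff.2 hz
  rw [IsBasisOn, and_iff_right hli, Set.ext_iff]
  refine forall_congr' fun Q => ?_
  rw [SetLike.mem_coe, Submodule.mem_span_range_iff_exists_fun]
  refine iff_congr Iff.rfl ⟨?_, ?_⟩
  · rintro ⟨c, rfl⟩
    exact ⟨c 0, by simp [symField_zero]⟩
  · rintro ⟨d, rfl⟩
    exact ⟨fun _ => d, by simp [symField_zero]⟩

/-- If `τ = 0` then `5cβ = 0`, so `c = 0` and the field is a multiple of `∂_x`. Thus any extension
shows itself in `τ`. -/
theorem hasTrivialAmax_iff {n : ℝ} {U : Set ℝ} (h : Admissible n U) (E : Equation) :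
    HasTrivialAmax n U E ↔ ∀ τ c, IsSym n E τ c → ∀ t ∈ E.I, τ t = 0 := by
  rw [HasTrivialAmax, isBasisOn_dX_iff h E.nonempty_I]
  constructor
  · intro hA τ c hs t ht
    obtain ⟨d, hd⟩ := (hA _).1 (symField_mem_Amax h hs 0)
    exact (symField_ext_iff E.nonempty_I (h.pos_mem 1 one_pos) hd).1 ht
  · intro hs Q
    rw [mem_Amax_iff h]
    constructor
    · rintro ⟨τ, c, d, hsym, rfl⟩
      have hτ := hs τ c hsym
      rw [hsym.eq_zero hτ]
      exact ⟨d, symField_congr E.isOpen_I hτ 0 d⟩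
    · rintro ⟨d, rfl⟩
      exact ⟨_, 0, d, isSym_zero n E, rfl⟩

theorem isBasisOn_kernel {n : ℝ} {U : Set ℝ} (h : Admissible n U) {I : Set ℝ} (hI : IsOpen I)
    (hc : I.OrdConnected) (hne : I.Nonempty) :
    IsBasisOn (dom I U) ![dX] {Q | ∀ E : Equation, E.I = I → Q ∈ Amax n U E} := by
  rw [isBasisOn_dX_iff h hne]
  intro Q
  constructor
  · intro hQ
    -- Two equations suffice: `β = 1` forces `a = 5c`, while `β = exp t` forces `a = 0` and `b =
    -- 5c`.
    have h1 := hQ ⟨I, hI, hc, hne, fun _ => 0, fun _ => 1, contDiffOn_const, contDiffOn_const,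
      fun _ _ => one_ne_zero⟩ rfl
    have h2 := hQ ⟨I, hI, hc, hne, fun _ => 0, Real.exp, contDiffOn_const,
      Real.contDiff_exp.contDiffOn, fun t _ => Real.exp_ne_zero t⟩ rfl
    rw [mem_Amax_iff_of_gauge h (fun _ _ => rfl)] at h1 h2
    obtain ⟨a, b, c, d, hβ, rfl⟩ := h1
    obtain ⟨a', b', c', d', hβ', e⟩ := h2
    obtain ⟨hτ, rfl, rfl⟩ := symField_ext_iff hne (h.pos_mem 1 one_pos) e
    obtain ⟨t₀, ht₀⟩ := hne
    have hac : a = 5 * c := by simpa using hβ t₀ ht₀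
    have hz : a - a' = 0 ∧ b - b' = 0 := affine_eq_zero hI ⟨t₀, ht₀⟩ fun t ht => by
      have := hτ ht
      simp only at this
      linear_combination this
    have hz' : a' = 0 ∧ a' + b' - 5 * c = 0 := affine_eq_zero hI ⟨t₀, ht₀⟩ fun t ht => by
      have := hβ' t ht
      simp only [Real.deriv_exp] at this
      refine mul_right_cancel₀ (Real.exp_ne_zero t) ?_
      linear_combination this
    have ha : a = 0 := by linarith
    have hb : b = 0 := by linarith
    have hc0 : c = 0 := by linarith
    subst ha hb hc0
    exact ⟨d, symField_congr hI (fun t _ => by simp) 0 d⟩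
  · rintro ⟨d, rfl⟩ E rfl
    exact symField_mem_Amax h (isSym_zero n E) d

/-! ### The algebras of the listed cases -/

/-- The logarithmic derivative of the coefficient `β` of the case. -/
def Case.slope : Case → ℝ → ℝ
  | .power _ ρ _ => fun t => ρ / t
  | .exp _ => fun _ => 1
  | .const _ => fun _ => 0

theorem Case.deriv_β (c : Case) {t : ℝ} (ht : t ∈ c.tDomain) :
    deriv c.β t = c.slope t * c.β t := by
  cases c with
  | power ε ρ hρ =>
    have ht' : (0 : ℝ) < t := ht
    simp only [Case.β, Case.slope]
    rw [((Real.hasDerivAt_rpow_const (p := ρ) (Or.inl ht'.ne')).const_mul _).deriv,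
      Real.rpow_sub_one ht'.ne']
    ring
  | exp ε => simp [Case.β, Case.slope]
  | const ε => simp [Case.β, Case.slope]

theorem IsRepresentative.deriv_β {c : Case} {E : Equation} (hE : IsRepresentative c E) {t : ℝ}
    (ht : t ∈ E.I) : deriv E.β t = c.slope t * E.β t := by
  rw [deriv_eqOn E.isOpen_I (fun s hs => (hE.2 s hs).2) ht, c.deriv_β (hE.1 ht), (hE.2 t ht).2]

theorem IsRepresentative.mem_Amax_iff {n : ℝ} {U : Set ℝ} (h : Admissible n U) {c : Case}
    {E : Equation} (hE : IsRepresentative c E) {Q : VField} : Q ∈ Amax n U E ↔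
      ∃ a b k d, (∀ t ∈ E.I, a + (a * t + b) * c.slope t = 5 * k) ∧
        Q = symField n E.I U (fun t => a * t + b) k d := by
  rw [mem_Amax_iff_of_gauge h fun t ht => (hE.2 t ht).1]
  have e : ∀ a b k, (∀ t ∈ E.I, a * E.β t + (a * t + b) * deriv E.β t = 5 * k * E.β t) ↔
      ∀ t ∈ E.I, a + (a * t + b) * c.slope t = 5 * k := by
    refine fun a b k => forall₂_congr fun t ht => ?_
    rw [hE.deriv_β ht]
    refine ⟨fun h => mul_right_cancel₀ (E.β_ne_zero t ht) ?_, fun h => ?_⟩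
    · linear_combination h
    · linear_combination E.β t * h
  simp only [e]

theorem isBasisOn_of {k : ℕ} {D : Set (ℝ × ℝ × ℝ)} {v : Fin k → VField} {A : Set VField}
    (hli : ∀ g : Fin k → ℝ, (restrict D fun p => ∑ i, g i • v i p) = 0 → ∀ i, g i = 0)
    (hA : ∀ Q, Q ∈ A ↔ ∃ g : Fin k → ℝ, Q = restrict D fun p => ∑ i, g i • v i p) :
    IsBasisOn D v A := by
  have hsum : ∀ g : Fin k → ℝ,
      ∑ i, g i • restrict D (v i) = restrict D fun p => ∑ i, g i • v i p := by
    intro g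
    funext p
    rw [Finset.sum_apply]
    by_cases hp : p ∈ D <;> simp [restrict, hp]
  refine ⟨Fintype.linearIndependent_iff.2 fun g hg => hli g (hsum g ▸ hg), Set.ext fun Q => ?_⟩
  rw [hA, SetLike.mem_coe, Submodule.mem_span_range_iff_exists_fun]
  simp only [hsum, eq_comm]

theorem restrict_apply {D : Set (ℝ × ℝ × ℝ)} {V : VField} {p : ℝ × ℝ × ℝ} (hp : p ∈ D) :
    restrict D V p = V p := by rw [restrict, Set.indicator_of_mem hp]

theorem symField_affine (n : ℝ) (I U : Set ℝ) (a b c d : ℝ) :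
    symField n I U (fun t => a * t + b) c d =
      restrict (dom I U) fun p => (a * p.1 + b, c * p.2.1 + d, (c - a) / n * p.2.2) := by
  rw [symField, deriv_affine]

theorem isBasisOn_Amax {n : ℝ} {U : Set ℝ} (h : Admissible n U) {c : Case} {E : Equation}
    (hE : IsRepresentative c E) : IsBasisOn (dom E.I U) (c.basis n) (Amax n U E) := by
  have hn := h.ne_zero
  have h1 := h.pos_mem 1 one_pos
  obtain ⟨t₀, ht₀⟩ := E.nonempty_I
  cases c with
  | power ε ρ hρ =>
    have hpos : ∀ t ∈ E.I, 0 < t := hE.1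
    change IsBasisOn (k := 2) _
      ![dX, fun p => (5 * n * p.1, (ρ + 1) * n * p.2.1, (ρ - 4) * p.2.2)] _
    refine isBasisOn_of (fun g hg => ?_) fun Q => ?_
    · have e := congrFun hg (t₀, 0, 1)
      rw [restrict_apply (mem_dom.2 ⟨ht₀, h1⟩)] at e
      have := (hpos t₀ ht₀).ne'
      simp [Fin.sum_univ_two, dX, hn, this] at e
      rw [Fin.forall_fin_two]
      exact ⟨by simpa [e.1] using e.2.1, e.1⟩
    · rw [hE.mem_Amax_iff h]
      simp only [symField_affine]
      constructor
      · rintro ⟨a, b, k, d, hs, rfl⟩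
        -- After multiplication by `t`, the condition `a + (a t + b) ρ / t = 5 k` is affine in `t`
        -- and splits.
        obtain ⟨hk, hb⟩ : a + a * ρ - 5 * k = 0 ∧ b * ρ = 0 :=
          affine_eq_zero E.isOpen_I ⟨t₀, ht₀⟩ fun t ht => by
            have ht' := (hpos t ht).ne'
            have := hs t ht
            simp only [Case.slope] at this
            field_simp at this
            linear_combination this
        have hb := (mul_eq_zero.1 hb).resolve_right hρ
        subst hb
        obtain rfl : k = (a + a * ρ) / 5 := by linarith
        refine ⟨![d, a / (5 * n)], ?_⟩
        congr 1
        funext p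
        simp only [Fin.sum_univ_two]
        refine Prod.ext ?_ (Prod.ext ?_ ?_) <;> simp [dX] <;> field_simp <;> ring
      · rintro ⟨g, rfl⟩
        refine ⟨5 * n * g 1, 0, (ρ + 1) * n * g 1, g 0, fun t ht => ?_, ?_⟩
        · have ht' := (hpos t ht).ne'
          simp only [Case.slope]
          field_simp
          ring
        · congr 1
          funext p
          simp only [Fin.sum_univ_two]
          refine Prod.ext ?_ (Prod.ext ?_ ?_) <;> simp [dX] <;> field_simp <;> ring
  | exp ε =>
    change IsBasisOn (k := 2) _
      ![dX, fun p => (5 * n, n * p.2.1, p.2.2)] _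
    refine isBasisOn_of (fun g hg => ?_) fun Q => ?_
    · have e := congrFun hg (t₀, 0, 1)
      rw [restrict_apply (mem_dom.2 ⟨ht₀, h1⟩)] at e
      simp [Fin.sum_univ_two, dX, hn] at e
      rw [Fin.forall_fin_two]
      exact ⟨by simpa [e.1] using e.2, e.1⟩
    · rw [hE.mem_Amax_iff h]
      simp only [symField_affine]
      constructor
      · rintro ⟨a, b, k, d, hs, rfl⟩
        obtain ⟨ha, hb⟩ : a = 0 ∧ a + b - 5 * k = 0 :=
          affine_eq_zero E.isOpen_I ⟨t₀, ht₀⟩ fun t ht => by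
            have := hs t ht
            simp only [Case.slope] at this
            linear_combination this
        subst ha
        obtain rfl : k = b / 5 := by linarith
        refine ⟨![d, b / (5 * n)], ?_⟩
        congr 1
        funext p
        simp only [Fin.sum_univ_two]
        refine Prod.ext ?_ (Prod.ext ?_ ?_) <;> simp [dX, -mul_eq_mul_right_iff] <;> field_simp <;> ring
      · rintro ⟨g, rfl⟩
        refine ⟨0, 5 * n * g 1, n * g 1, g 0, fun t ht => ?_, ?_⟩
        · simp only [Case.slope]
          ring
        · congr 1
          funext p
          simp only [Fin.sum_univ_two]
          refine Prod.ext ?_ (Prod.ext ?_ ?_) <;> simp [dX, -mul_eq_mul_right_iff] <;> field_simp <;> ring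
  | const ε =>
    change IsBasisOn (k := 3) _
      ![dX, fun _ => (1, 0, 0), fun p => (5 * n * p.1, n * p.2.1, -4 * p.2.2)] _
    refine isBasisOn_of (fun g hg => ?_) fun Q => ?_
    · have e := congrFun hg (t₀, 0, 1)
      rw [restrict_apply (mem_dom.2 ⟨ht₀, h1⟩)] at e
      simp [Fin.sum_univ_three, dX] at e
      have e1 : g 1 = 0 := by simpa [e.2.2] using e.1
      intro i
      fin_cases i
      exacts [e.2.1, e1, e.2.2]
    · rw [hE.mem_Amax_iff h]
      simp only [symField_affine]
      constructor
      · rintro ⟨a, b, k, d, hs, rfl⟩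
        have hk := hs t₀ ht₀
        simp only [Case.slope, mul_zero, add_zero] at hk
        subst hk
        refine ⟨![d, b, k / n], ?_⟩
        congr 1
        funext p
        simp only [Fin.sum_univ_three]
        refine Prod.ext ?_ (Prod.ext ?_ ?_) <;> simp [dX] <;> field_simp <;> ring
      · rintro ⟨g, rfl⟩
        refine ⟨5 * n * g 2, g 1, n * g 2, g 0, fun t ht => ?_, ?_⟩
        · simp only [Case.slope]
          ring
        · congr 1
          funext p
          simp only [Fin.sum_univ_three]
          refine Prod.ext ?_ (Prod.ext ?_ ?_) <;> simp [dX] <;> field_simp <;> ring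

/-! ### Reduction to the listed cases -/

theorem exists_unit_mul_abs {K : ℝ} (hK : K ≠ 0) : ∃ ε : ℤˣ, K = ((ε : ℤ) : ℝ) * |K| := by
  rcases lt_or_gt_of_ne hK with h | h
  · exact ⟨-1, by simp [abs_of_neg h]⟩
  · exact ⟨1, by simp [abs_of_pos h]⟩

/-- As five is odd, the real fifth root of `p r` has the sign of `p`, which is what `δ₁ T_t > 0`
demands for `T_t = p`. -/
theorem exists_pow_five_div_eq {p r : ℝ} (hp : p ≠ 0) (hr : 0 < r) :
    ∃ δ : ℝ, 0 < δ * p ∧ δ ^ 5 / p = r := by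
  have key : ∀ q : ℝ, 0 < q → ∃ δ : ℝ, 0 < δ ∧ δ ^ 5 = q * r := by
    intro q hq
    refine ⟨(q * r) ^ ((5 : ℕ) : ℝ)⁻¹, by positivity, ?_⟩
    exact Real.rpow_inv_natCast_pow (by positivity) (by norm_num)
  rcases lt_or_gt_of_ne hp with h | h
  · obtain ⟨δ, hδ, e⟩ := key (-p) (neg_pos.2 h)
    refine ⟨-δ, by nlinarith, ?_⟩
    rw [div_eq_iff hp]
    linear_combination -e
  · obtain ⟨δ, hδ, e⟩ := key p h
    refine ⟨δ, by positivity, ?_⟩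
    rw [div_eq_iff hp, e, mul_comm]

/-- Normalization of an equation whose coefficient `β` is proportional, up to an affine change of
`t`, to the coefficient of one of the cases. -/
theorem gEquiv_of_eq_mul {n : ℝ} (hn : n ≠ 0) {E : Equation} (hα : ∀ t ∈ E.I, E.α t = 0)
    {C : ℤˣ → Case} {B : ℝ → ℝ} {D : Set ℝ} (hC : ∀ ε s, (C ε).β s = ((ε : ℤ) : ℝ) * B s)
    (hD : ∀ ε, (C ε).tDomain = D) {K p q : ℝ} (hK : K ≠ 0) (hp : p ≠ 0)
    (hmem : ∀ t ∈ E.I, p * t + q ∈ D) (hβ : ∀ t ∈ E.I, E.β t = K * B (p * t + q)) :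
    ∃ (c : Case) (E' : Equation), IsRepresentative c E' ∧ GEquiv n E E' := by
  obtain ⟨ε, hε⟩ := exists_unit_mul_abs hK
  obtain ⟨δ, hδ, hδ5⟩ := exists_pow_five_div_eq hp (inv_pos.2 (abs_pos.2 hK))
  obtain ⟨g, hgT, hgδ⟩ : ∃ g : EquivTransf E.I, g.T = (fun t => p * t + q) ∧ g.δ₁ = δ :=
    ⟨⟨fun t => p * t + q, δ, 0, ContDiff.contDiffOn (by fun_prop),
      fun t _ => by rw [deriv_affine]; exact hδ⟩, rfl, rfl⟩
  obtain ⟨E', hE'⟩ := g.exists_maps hn E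
  refine ⟨C ε, E', ⟨?_, ?_⟩, g, hE'⟩ <;> rw [hE'.1]
  · rintro _ ⟨t, ht, rfl⟩
    rw [hgT, hD]
    exact hmem t ht
  · rintro _ ⟨t, ht, rfl⟩
    obtain ⟨e1, e2⟩ := hE'.2 t ht
    rw [e1, e2, hgT, deriv_affine, deriv_const, hα t ht, hgδ, hδ5, hC, hβ t ht]
    have := (abs_pos.2 hK).ne'
    refine ⟨by simp, ?_⟩
    refine (inv_mul_eq_iff_eq_mul₀ this).2 ?_
    linear_combination B (p * t + q) * hε

theorem exists_case_of_deriv_eq_zero {n : ℝ} (hn : n ≠ 0) {E : Equation}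
    (hα : ∀ t ∈ E.I, E.α t = 0) (hβ : ∀ t ∈ E.I, deriv E.β t = 0) :
    ∃ (c : Case) (E' : Equation), IsRepresentative c E' ∧ GEquiv n E E' := by
  obtain ⟨K, hK⟩ := E.isOpen_I.exists_is_const_of_deriv_eq_zero E.ordConnected_I.isPreconnected
    (E.smooth_β.differentiableOn (by simp)) hβ
  obtain ⟨t₀, ht₀⟩ := E.nonempty_I
  exact gEquiv_of_eq_mul hn hα (C := Case.const) (B := fun _ => 1) (D := univ) (K := K) (p := 1)
    (q := 0) (fun ε s => by simp [Case.β]) (fun _ => rfl) (hK t₀ ht₀ ▸ E.β_ne_zero t₀ ht₀)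
    one_ne_zero (fun _ _ => mem_univ _) fun t ht => by rw [hK t ht, mul_one]

theorem exists_eq_const_mul {E : Equation} {f f' : ℝ → ℝ} (hf : ∀ t ∈ E.I, f t ≠ 0)
    (hf' : ∀ t ∈ E.I, HasDerivAt f (f' t) t)
    (h : ∀ t ∈ E.I, deriv E.β t * f t = E.β t * f' t) :
    ∃ K, K ≠ 0 ∧ ∀ t ∈ E.I, E.β t = K * f t := by
  have hd : ∀ t ∈ E.I, HasDerivAt (fun t => E.β t / f t) 0 t := fun t ht => by
    have := (E.hasDerivAt_β ht).div (hf' t ht) (hf t ht)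
    rwa [h t ht, sub_self, zero_div] at this
  obtain ⟨K, hK⟩ := E.isOpen_I.exists_is_const_of_deriv_eq_zero E.ordConnected_I.isPreconnected
    (fun t ht => (hd t ht).differentiableAt.differentiableWithinAt) fun t ht => (hd t ht).deriv
  obtain ⟨t₀, ht₀⟩ := E.nonempty_I
  refine ⟨K, ?_, fun t ht => ?_⟩
  · rw [← hK t₀ ht₀]
    exact div_ne_zero (E.β_ne_zero t₀ ht₀) (hf t₀ ht₀)
  · rw [← hK t ht, div_mul_cancel₀ _ (hf t ht)]

/-- The equation `(a t + b) β_t = (5 c - a) β` is integrated explicitly: for `a = 0` by a constant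
or an exponential, for `a ≠ 0` by a constant or a power with exponent `5 c / a - 1`. -/
theorem exists_case_of_gauge {n : ℝ} (hn : n ≠ 0) {E : Equation} (hα : ∀ t ∈ E.I, E.α t = 0)
    {a b c : ℝ} (hβ : ∀ t ∈ E.I, a * E.β t + (a * t + b) * deriv E.β t = 5 * c * E.β t)
    (hne : ∃ t ∈ E.I, a * t + b ≠ 0) :
    ∃ (c : Case) (E' : Equation), IsRepresentative c E' ∧ GEquiv n E E' := by
  by_cases ha : a = 0
  · subst ha
    have hb : b ≠ 0 := by
      obtain ⟨t, -, ht⟩ := hne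
      simpa using ht
    by_cases hc : c = 0
    · subst hc
      refine exists_case_of_deriv_eq_zero hn hα fun t ht => ?_
      simpa [hb] using hβ t ht
    · obtain ⟨K, hK, hKβ⟩ := exists_eq_const_mul (E := E)
        -- The summand `0` gives the argument the shape `p * t + q` required by `gEquiv_of_eq_mul`.
        (f := fun t => Real.exp (5 * c / b * t + 0))
        (f' := fun t => Real.exp (5 * c / b * t + 0) * (5 * c / b)) (fun t _ => Real.exp_ne_zero _)
        (fun t _ => by
          have := (((hasDerivAt_id t).const_mul (5 * c / b)).add_const 0).exp
          simpa using this) (fun t ht => by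
          have := hβ t ht
          field_simp
          linear_combination this)
      exact gEquiv_of_eq_mul hn hα (C := Case.exp) (B := Real.exp) (D := univ)
        (fun _ _ => rfl) (fun _ => rfl) hK (div_ne_zero (mul_ne_zero (by norm_num) hc) hb)
        (fun _ _ => mem_univ _) hKβ
  · by_cases hc : 5 * c = a
    · refine exists_case_of_deriv_eq_zero hn hα ?_
      -- The equation yields `β_t = 0` only off the possible zero of `a t + b`; continuity of `β_t`
      -- covers that point.
      have h0 : ∀ t ∈ E.I, t ≠ -b / a → deriv E.β t = 0 := by
        intro t ht hta
        have e : (a * t + b) * deriv E.β t = 0 := by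
          linear_combination hβ t ht + E.β t * hc
        refine (mul_eq_zero.1 e).resolve_left fun h => hta ?_
        field_simp
        linarith
      intro t ht
      by_contra hne
      have hcont : ContinuousAt (deriv E.β) t :=
        (contDiffOn_deriv E.isOpen_I E.smooth_β).continuousOn.continuousAt (E.isOpen_I.mem_nhds ht)
      have hev : ∀ᶠ s in nhdsWithin t {t}ᶜ, deriv E.β s ≠ 0 ∧ s ∈ E.I ∧ s ≠ t :=
        (eventually_nhdsWithin_of_eventually_nhds (hcont.eventually_ne hne)).and
          ((eventually_nhdsWithin_of_eventually_nhds (E.isOpen_I.mem_nhds ht)).and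
            self_mem_nhdsWithin)
      obtain ⟨s, hs, hsI, hst⟩ := hev.exists
      have e1 : t = -b / a := by_contra fun h => hne (h0 t ht h)
      have e2 : s = -b / a := by_contra fun h => hs (h0 s hsI h)
      exact hst (e2.trans e1.symm)
    -- At a zero of `a t + b` the equation would give `a β = 5 c β`, against `β ≠ 0` and `5 c ≠ a`.
    · have hz : ∀ t ∈ E.I, a * t + b ≠ 0 := by
        intro t ht h
        have e := hβ t ht
        rw [h, zero_mul, add_zero] at e
        exact hc (mul_right_cancel₀ (E.β_ne_zero t ht) e).symm
      obtain ⟨t₀, ht₀⟩ := E.nonempty_I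
      obtain ⟨p, q, hp, hpq, hpos⟩ : ∃ p q : ℝ, p ≠ 0 ∧ b * p = a * q ∧
          ∀ t ∈ E.I, 0 < p * t + q := by
        have hcont : ContinuousOn (fun t : ℝ => a * t + b) E.I := by fun_prop
        have hsame : ∀ t ∈ E.I, 0 < (a * t₀ + b) * (a * t + b) := by
          intro t ht
          by_contra hle
          have hle' := not_lt.1 hle
          have hI := (E.ordConnected_I.isPreconnected.image _ hcont).ordConnected
          have h1 : a * t₀ + b ∈ (fun t => a * t + b) '' E.I := ⟨t₀, ht₀, rfl⟩
          have h2 : a * t + b ∈ (fun t => a * t + b) '' E.I := ⟨t, ht, rfl⟩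
          have h3 : (0 : ℝ) ∈ (fun t => a * t + b) '' E.I := by
            rcases mul_nonpos_iff.1 hle' with ⟨h, h'⟩ | ⟨h, h'⟩
            · exact hI.out h2 h1 ⟨h', h⟩
            · exact hI.out h1 h2 ⟨h, h'⟩
          obtain ⟨s, hs, hs0⟩ := h3
          exact hz s hs hs0
        -- Since `a t + b` keeps its sign on the interval, multiplying it by its value at `t₀` makes
        -- it positive, so that real powers are available.
        exact ⟨(a * t₀ + b) * a, (a * t₀ + b) * b, mul_ne_zero (hz t₀ ht₀) ha, by ring,
          fun t ht => by have := hsame t ht; linarith⟩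
      obtain ⟨K, hK, hKβ⟩ := exists_eq_const_mul (E := E)
        (f := fun t => (p * t + q) ^ (5 * c / a - 1))
        (f' := fun t => p * (5 * c / a - 1) * (p * t + q) ^ (5 * c / a - 1 - 1))
        (fun t ht => (Real.rpow_pos_of_pos (hpos t ht) _).ne')
        (fun t ht => by
          have := (((hasDerivAt_id t).const_mul p).add_const q).rpow_const (p := 5 * c / a - 1)
            (Or.inl (hpos t ht).ne')
          simpa using this) (fun t ht => by
          have e := hβ t ht
          have hne := (hpos t ht).ne'
          rw [Real.rpow_sub_one hne (5 * c / a - 1)]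
          generalize (p * t + q) ^ (5 * c / a - 1) = X
          have e' : (p * t + q) * deriv E.β t * a = E.β t * p * (5 * c - a) := by
            linear_combination p * e - deriv E.β t * hpq
          field_simp
          linear_combination e' * X)
      exact gEquiv_of_eq_mul hn hα
        (C := fun ε => Case.power ε (5 * c / a - 1) fun h => hc (by field_simp at h; linarith))
        (B := fun t => t ^ (5 * c / a - 1)) (D := Ioi 0) (fun _ _ => rfl) (fun _ => rfl) hK hp hpos
        hKβ

theorem exists_case_of_not_trivial {n : ℝ} {U : Set ℝ} (h : Admissible n U) {E : Equation}
    (hE : ¬ HasTrivialAmax n U E) :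
    ∃ (c : Case) (E' : Equation), IsRepresentative c E' ∧ GEquiv n E E' := by
  rw [hasTrivialAmax_iff h] at hE
  push Not at hE
  obtain ⟨τ, c, hs, t, ht, hτt⟩ := hE
  obtain ⟨E₁, ⟨g, hg⟩, hα⟩ := exists_gauge h.ne_zero E
  obtain ⟨τ₁, hτ₁, hT⟩ := exists_push hg hs.smooth
  obtain ⟨a, b, hab, hβ⟩ := (isSym_iff_of_gauge h.ne_zero hα).1
    ((isSym_iff_of_transport h.ne_zero hg hs.smooth hτ₁ hT).1 hs)
  have hne : a * g.T t + b ≠ 0 := by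
    have e := hab (hg.mem ht)
    rw [← hT t ht] at e
    simp only at e
    rw [← e]
    exact mul_ne_zero hτt (g.deriv_ne_zero ht)
  obtain ⟨c', E', hrep, hE'⟩ := exists_case_of_gauge h.ne_zero hα hβ ⟨_, hg.mem ht, hne⟩
  exact ⟨c', E', hrep, GEquiv.trans h.ne_zero ⟨g, hg⟩ hE'⟩

/-- The witnesses are the `τ`-components `5 t`, `5` and `1` of the listed operators, up to scaling;
`t > 0` keeps the first one nonzero. -/
theorem IsRepresentative.exists_isSym {n : ℝ} (hn : n ≠ 0) {c : Case} {E : Equation}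
    (hE : IsRepresentative c E) : ∃ τ k, IsSym n E τ k ∧ ∀ t ∈ E.I, τ t ≠ 0 := by
  have key : ∀ a b k, (∀ t ∈ E.I, a + (a * t + b) * c.slope t = 5 * k) →
      IsSym n E (fun t => a * t + b) k := fun a b k hs =>
    (isSym_iff_of_gauge hn fun t ht => (hE.2 t ht).1).2 ⟨a, b, fun _ _ => rfl, fun t ht => by
      rw [hE.deriv_β ht]
      linear_combination E.β t * hs t ht⟩
  cases c with
  | power ε ρ hρ =>
    have hpos : ∀ t ∈ E.I, t ≠ 0 := fun t ht => (show 0 < t from hE.1 ht).ne'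
    refine ⟨_, _, key 5 0 (1 + ρ) fun t ht => ?_, fun t ht => by simpa using hpos t ht⟩
    have := hpos t ht
    simp only [Case.slope]
    field_simp
    ring
  | exp ε => exact ⟨_, _, key 0 5 1 fun t ht => by simp [Case.slope], fun t ht => by simp⟩
  | const ε => exact ⟨_, _, key 0 1 0 fun t ht => by simp [Case.slope], fun t ht => by simp⟩

theorem not_trivial_of_gEquiv {n : ℝ} {U : Set ℝ} (h : Admissible n U) {c : Case}
    {E E' : Equation} (hE' : IsRepresentative c E') (hg : GEquiv n E E') :
    ¬ HasTrivialAmax n U E := by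
  rw [hasTrivialAmax_iff h]
  intro hall
  obtain ⟨g, hg⟩ := hg
  obtain ⟨τ', k, hs, hne⟩ := hE'.exists_isSym h.ne_zero
  obtain ⟨τ, hτ, hT⟩ := exists_pull hg hs.smooth
  obtain ⟨t, ht⟩ := E.nonempty_I
  have h0 := hall τ k ((isSym_iff_of_transport h.ne_zero hg hτ hs.smooth hT).2 hs) t ht
  have e := hT t ht
  rw [h0, zero_mul] at e
  exact hne _ (hg.mem ht) e.symm

/-! ### Inequivalence of the listed cases -/

/-- The sign of the coefficient `β` of the case. -/
def Case.sign : Case → ℤˣ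
  | .power ε _ _ => ε
  | .exp ε => ε
  | .const ε => ε

theorem Case.sign_mul_β_pos (c : Case) {t : ℝ} (ht : t ∈ c.tDomain) :
    0 < ((c.sign : ℤ) : ℝ) * c.β t := by
  have hε : ∀ (ε : ℤˣ) (r : ℝ), 0 < r → 0 < ((ε : ℤ) : ℝ) * (((ε : ℤ) : ℝ) * r) := by
    intro ε r hr
    rcases Int.units_eq_one_or ε with rfl | rfl <;> simpa using hr
  cases c with
  | power ε ρ hρ => exact hε ε _ (Real.rpow_pos_of_pos ht ρ)
  | exp ε => exact hε ε _ (Real.exp_pos t)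
  | const ε => simp [Case.sign, Case.β]

/-- Two equations with `α = 0` can be linked only by `T = p t + q`. The sign of `β` then gives `ε`,
and matching logarithmic derivatives as functions on an interval gives the case and `ρ`. -/
theorem IsRepresentative.case_eq {n : ℝ} (hn : n ≠ 0) {c c' : Case} {E E' : Equation}
    (hE : IsRepresentative c E) (hE' : IsRepresentative c' E') (h : GEquiv n E E') : c = c' := by
  obtain ⟨g, hg⟩ := h
  have hT2 : ∀ t ∈ E.I, deriv (deriv g.T) t = 0 := fun t ht => by
    have e := (hg.2 t ht).1
    rw [(hE.2 t ht).1, (hE'.2 _ (hg.mem ht)).1, zero_div, zero_add] at e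
    have := g.deriv_ne_zero ht
    exact (div_eq_zero_iff.1 e.symm).resolve_right (mul_ne_zero hn (pow_ne_zero 2 this))
  have hpre := E.ordConnected_I.isPreconnected
  obtain ⟨p, hp⟩ := E.isOpen_I.exists_is_const_of_deriv_eq_zero hpre
    ((contDiffOn_deriv E.isOpen_I g.smooth_T).differentiableOn (by simp)) hT2
  obtain ⟨q, hq⟩ := E.isOpen_I.exists_eq_add_of_deriv_eq (g := fun t => p * t) hpre
    (g.smooth_T.differentiableOn (by simp)) (by fun_prop) (fun t ht => by rw [hp t ht]; simp)
  obtain ⟨t₀, ht₀⟩ := E.nonempty_I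
  have hp0 : p ≠ 0 := hp t₀ ht₀ ▸ g.deriv_ne_zero ht₀
  have hK : 0 < g.δ₁ ^ 5 / p := by
    have := g.pos t₀ ht₀
    rw [hp t₀ ht₀] at this
    -- The sign condition `δ₁ T_t > 0` of the group is what keeps `ε` invariant.
    have h2 : g.δ₁ ^ 5 / p = (g.δ₁ * p) * (g.δ₁ ^ 2 / p) ^ 2 := by field_simp
    have h3 : g.δ₁ ≠ 0 := fun h0 => by simp [h0] at this
    rw [h2]
    positivity
  have hβ : ∀ t ∈ E.I, E'.β (g.T t) = g.δ₁ ^ 5 / p * E.β t := fun t ht => by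
    rw [(hg.2 t ht).2, hp t ht]
  have hsign : c.sign = c'.sign := by
    have h1 := c.sign_mul_β_pos (hE.1 ht₀)
    have h2 := c'.sign_mul_β_pos (hE'.1 (hg.mem ht₀))
    rw [← (hE'.2 _ (hg.mem ht₀)).2, hβ t₀ ht₀, (hE.2 t₀ ht₀).2] at h2
    have h3 := mul_pos h1 h2
    rcases Int.units_eq_one_or c.sign with e | e <;>
      rcases Int.units_eq_one_or c'.sign with e' | e' <;> rw [e, e'] at h3 ⊢
    · exfalso
      simp only [Units.val_one, Int.cast_one, Units.val_neg, Int.cast_neg] at h3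
      nlinarith [mul_nonneg hK.le (mul_self_nonneg (c.β t₀))]
    · exfalso
      simp only [Units.val_one, Int.cast_one, Units.val_neg, Int.cast_neg] at h3
      nlinarith [mul_nonneg hK.le (mul_self_nonneg (c.β t₀))]
  -- Logarithmic differentiation of `β'(p t + q) = (δ₁⁵ / p) β(t)` removes the constant factor.
  have hslope : ∀ t ∈ E.I, p * c'.slope (p * t + q) = c.slope t := by
    intro t ht
    have hTt : g.T t = p * t + q := hq ht
    have h1 := (E'.hasDerivAt_β (hg.mem ht)).comp t (g.hasDerivAt E.isOpen_I ht)
    have h2 := (E.hasDerivAt_β ht).const_mul (g.δ₁ ^ 5 / p)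
    have he : E'.β ∘ g.T =ᶠ[nhds t] fun t => g.δ₁ ^ 5 / p * E.β t := by
      filter_upwards [E.isOpen_I.mem_nhds ht] with s hs
      exact hβ s hs
    have e := h1.unique (h2.congr_of_eventuallyEq he)
    rw [hE'.deriv_β (hg.mem ht), hE.deriv_β ht, hβ t ht, hp t ht, hTt] at e
    refine mul_right_cancel₀ (mul_ne_zero hK.ne' (E.β_ne_zero t ht)) ?_
    linear_combination e
  have hdom : ∀ t ∈ E.I, t ∈ c.tDomain ∧ p * t + q ∈ c'.tDomain := fun t ht =>
    ⟨hE.1 ht, (show g.T t = p * t + q from hq ht) ▸ hE'.1 (hg.mem ht)⟩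
  have hne : E.I.Nonempty := ⟨t₀, ht₀⟩
  clear hE hE'
  cases c with
  | power ε ρ hρ =>
    have hpos : ∀ t ∈ E.I, t ≠ 0 := fun t ht => (show 0 < t from (hdom t ht).1).ne'
    cases c' with
    | power ε' ρ' hρ' =>
      have h0 : p * ρ' - p * ρ = 0 ∧ -(ρ * q) = 0 := affine_eq_zero E.isOpen_I hne fun t ht => by
        have h1 := hpos t ht
        have h2 : p * t + q ≠ 0 := (show 0 < p * t + q from (hdom t ht).2).ne'
        have e := hslope t ht
        simp only [Case.slope] at e
        field_simp at e
        linear_combination e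
      have e : ρ = ρ' := (mul_left_cancel₀ hp0 (sub_eq_zero.1 h0.1)).symm
      subst e
      simp only [Case.sign] at hsign
      rw [hsign]
    | exp ε' =>
      have h0 : p = 0 ∧ -ρ = 0 := affine_eq_zero E.isOpen_I hne fun t ht => by
        have h1 := hpos t ht
        have e := hslope t ht
        simp only [Case.slope] at e
        field_simp at e
        linear_combination e
      exact absurd h0.1 hp0
    | const ε' =>
      have e := hslope t₀ ht₀
      have h1 := hpos t₀ ht₀
      simp [Case.slope, h1, hρ, eq_comm] at e
  | exp ε =>
    cases c' with
    | power ε' ρ' hρ' =>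
      have h0 : -p = 0 ∧ p * ρ' - q = 0 := affine_eq_zero E.isOpen_I hne fun t ht => by
        have h2 : p * t + q ≠ 0 := (show 0 < p * t + q from (hdom t ht).2).ne'
        have e := hslope t ht
        simp only [Case.slope] at e
        field_simp at e
        linear_combination e
      exact absurd (neg_eq_zero.1 h0.1) hp0
    | exp ε' =>
      simp only [Case.sign] at hsign
      rw [hsign]
    | const ε' =>
      have e := hslope t₀ ht₀
      simp [Case.slope] at e
  | const ε =>
    cases c' with
    | power ε' ρ' hρ' =>
      have e := hslope t₀ ht₀
      have h2 : p * t₀ + q ≠ 0 := (show 0 < p * t₀ + q from (hdom t₀ ht₀).2).ne'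
      simp [Case.slope, hp0, hρ', h2] at e
    | exp ε' =>
      have e := hslope t₀ ht₀
      simp [Case.slope, hp0] at e
    | const ε' =>
      simp only [Case.sign] at hsign
      rw [hsign]

end FKdV

end

/-! ### The group classification theorem -/

theorem proposition1 (n : ℝ) (U : Set ℝ)
    (hU : (U = Set.univ ∧ ∃ k : ℕ, 2 ≤ k ∧ n = k) ∨ (U = Set.Ioi 0 ∧ n ≠ 0 ∧ n ≠ 1)) :
    -- the gauge `α = 0`
    (∀ E : FKdV.Equation, ∃ E' : FKdV.Equation,
      FKdV.GEquiv n E E' ∧ ∀ t ∈ E'.I, E'.α t = 0) ∧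
    -- the transformations from `G^∼` relate the maximal Lie invariance algebras
    (∀ (E E' : FKdV.Equation) (g : FKdV.EquivTransf E.I), g.Maps n E E' →
      FKdV.Amax n U E =
        (fun V => FKdV.restrict (FKdV.dom E.I U) (VectorField.pullback ℝ (g.toFun n) V)) ''
          FKdV.Amax n U E') ∧
    -- the kernel of the maximal Lie invariance algebras is `⟨∂_x⟩`
    (∀ I : Set ℝ, IsOpen I → I.OrdConnected → I.Nonempty →
      FKdV.IsBasisOn (FKdV.dom I U) ![FKdV.dX]
        {Q | ∀ E : FKdV.Equation, E.I = I → Q ∈ FKdV.Amax n U E}) ∧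
    -- the algebras listed for the cases of extension
    (∀ (c : FKdV.Case) (E : FKdV.Equation), FKdV.IsRepresentative c E →
      FKdV.IsBasisOn (FKdV.dom E.I U) (c.basis n) (FKdV.Amax n U E)) ∧
    -- the list of the extensions is exhaustive
    (∀ E : FKdV.Equation, ¬ FKdV.HasTrivialAmax n U E ↔
      ∃ (c : FKdV.Case) (E' : FKdV.Equation), FKdV.IsRepresentative c E' ∧ FKdV.GEquiv n E E') ∧
    -- the listed cases are inequivalent
    (∀ (c c' : FKdV.Case) (E E' : FKdV.Equation),
      FKdV.IsRepresentative c E → FKdV.IsRepresentative c' E' → FKdV.GEquiv n E E' → c = c') := by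
  have h := FKdV.admissible_of hU
  exact ⟨FKdV.exists_gauge h.ne_zero, fun E E' g hg => FKdV.Amax_eq_image h hg,
    fun I hI hc hne => FKdV.isBasisOn_kernel h hI hc hne,
    fun c E hE => FKdV.isBasisOn_Amax h hE,
    fun E => ⟨FKdV.exists_case_of_not_trivial h,
      fun ⟨c, E', hE', hg⟩ => FKdV.not_trivial_of_gEquiv h hE' hg⟩,
    fun c c' E E' hE hE' hg => hE.case_eq h.ne_zero hE' hg⟩
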